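/- Let $\lambda$ be a singular cardinal. Suppose that $\square_\lambda$ holds, that is, there is a sequence $\langle C_\alpha\mid\alpha<\lambda^+\rangle$ such that for every nonzero limit ordinal $\alpha<\lambda^+$: (1) $C_\alpha$ is a closed and cofinal subset of $\alpha$ of order type $\le\lambda$; (2) if $\beta\in C_\alpha$ is nonzero and $\sup(C_\alpha\cap\beta)=\beta$, then $C_\beta=C_\alpha\cap\beta$. Suppose also that $\lambda^{<\mathrm{cf}(\lambda)}<\lambda^\lambda=\lambda^+$, where $\lambda^{<\kappa}=\sup_{\theta<\kappa}\lambda^\theta$ over cardinals $\theta$. Then there exists a homogeneous $\lambda^+$-Souslin tree which is moreover $\mathrm{cf}(\lambda)$-complete. Here a tree is a partially ordered set $\langle T,<\rangle$ such that $x_\downarrow=\{y\in T\mid y<x\}$ is well-ordered by $<$ for every $x\in T$; the height of $x$ is the order type of $x_\downarrow$, and the height of $T$ is the supremum of the heights of its nodes. A $\lambda^+$-Souslin tree is a tree of height $\lambda^+$ in which no subset of size $\lambda^+$ is a chain (a set of pairwise comparable nodes) or an antichain (a set of pairwise incomparable nodes). A tree is homogeneous if for any two nodes $x,y$ of the same height,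 the partially ordered sets $\{z\in T\mid x<z\}$ and $\{z\in T\mid y<z\}$ are isomorphic. A tree is $\kappa$-complete if for every chain $C\subseteq T$ of size $<\kappa$ there is $x\in T$ with $y<x$ for all $y\in C$. -/

import Mathlib

universe u

/-- `C` is a club in the ordinal `α`: a subset of `α` that is closed and cofinal in `α`. -/
def IsClubIn (C : Set Ordinal.{u}) (α : Ordinal.{u}) : Prop :=
  C ⊆ Set.Iio α ∧ IsClub ((fun x : Set.Iio α => (x : Ordinal.{u})) ⁻¹' C)

/-- `acc(C)`: the accumulation points of `C` lying in `C`, i.e. the nonzero `β ∈ C` such that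
`C ∩ β` is unbounded in `β`. -/
def accPoints (C : Set Ordinal.{u}) : Set Ordinal.{u} :=
  {β | β ∈ C ∧ β ≠ 0 ∧ sSup (C ∩ Set.Iio β) = β}

/-- The order type of a set of ordinals. -/
noncomputable def otp (C : Set Ordinal.{u}) : Ordinal.{u + 1} :=
  Ordinal.type (fun x y : C => x < y)

/-- `⟨C α | α < lam⁺⟩` is a `□_lam`-sequence (the values of `C` at other ordinals play no role). -/
structure IsSquareSeq (lam : Cardinal.{u}) (C : Ordinal.{u} → Set Ordinal.{u}) : Prop where
  isClubIn : ∀ α < (Order.succ lam).ord, Order.IsSuccLimit α → IsClubIn (C α) α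
  otp_le : ∀ α < (Order.succ lam).ord, Order.IsSuccLimit α →
    otp (C α) ≤ Ordinal.lift.{u + 1} lam.ord
  coherent : ∀ α < (Order.succ lam).ord, Order.IsSuccLimit α →
    ∀ β ∈ accPoints (C α), C β = C α ∩ Set.Iio β

/-- Jensen's square principle `□_lam`. -/
def JensenSquare (lam : Cardinal.{u}) : Prop :=
  ∃ C : Ordinal.{u} → Set Ordinal.{u}, IsSquareSeq lam C

/-- A (set-theoretic) tree: a partial order in which the set of strict predecessors of each
element is well-ordered. -/
class IsOrderTree (T : Type u) [PartialOrder T] : Prop where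
  isWellOrder_Iio : ∀ x : T, IsWellOrder (Set.Iio x) (fun y z => y < z)

/-- The height of a node: the order type of the set of its strict predecessors. -/
noncomputable def nodeHeight {T : Type u} [PartialOrder T] [IsOrderTree T] (x : T) :
    Ordinal.{u} :=
  @Ordinal.type (Set.Iio x) (fun y z => y < z) (IsOrderTree.isWellOrder_Iio x)

/-- The height of a tree: the supremum of the heights of its nodes. -/
noncomputable def treeHeight (T : Type u) [PartialOrder T] [IsOrderTree T] : Ordinal.{u} :=
  sSup (Set.range fun x : T => nodeHeight x)

/-- A `κ`-Souslin tree: a tree of height `κ` in which no set of size `κ` is a chain or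
an antichain (a set of pairwise incomparable nodes). -/
structure IsSouslinTree (κ : Cardinal.{u}) (T : Type u) [PartialOrder T] [IsOrderTree T] :
    Prop where
  treeHeight_eq : treeHeight T = κ.ord
  not_isChain : ∀ B : Set T, Cardinal.mk B = κ → ¬ IsChain (fun x y => x ≤ y) B
  not_isAntichain : ∀ B : Set T, Cardinal.mk B = κ → ¬ IsAntichain (fun x y => x ≤ y) B

/-- A tree is homogeneous if the cones strictly above any two nodes of the same height are
isomorphic. -/
def IsHomogeneousTree (T : Type u) [PartialOrder T] [IsOrderTree T] : Prop :=
  ∀ x y : T, nodeHeight x = nodeHeight y → Nonempty (Set.Ioi x ≃o Set.Ioi y)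

/-- A tree is `κ`-complete if every chain of size less than `κ` has a strict upper bound. -/
def IsCompleteTree (κ : Cardinal.{u}) (T : Type u) [PartialOrder T] : Prop :=
  ∀ C : Set T, IsChain (fun x y => x ≤ y) C → Cardinal.mk C < κ → ∃ x : T, C ⊆ Set.Iio x

/-! Write κ = cf λ and let W be the well-order of type λ⁺. A node of level a is a subset of a which,
at every γ ≤ a of cofinality at least κ, agrees on a final segment of γ with a fixed set b γ. Only
eventual behaviour is constrained, so the initial part of a node may be exchanged for any node of
that lower level: this gives homogeneity. Levels of cofinality below κ impose nothing, which gives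
completeness; since λ^μ ≤ λ for μ < κ, each level has at most λ nodes.

Everything rests on the choice of b. The square sequence is improved to a coherent ladder D that
guesses clubs, and λ^λ = λ⁺ lets points of W code matrices of λ many values. Together they give a
function g such that, for every X on W, some α of cofinality above κ and above any prescribed μ < λ
satisfies g β τ = X τ for cofinally many limit points τ of D α, where β is the point of D α after τ
(`IsCoherentLadder.exists_guessing`). The set b α is glued along D α: between τ and β it uses the
guess g β τ, then b β. By coherence b α extends b τ at limit points τ of D α, so every strategy for
extending the b τ is followed cofinally often by some b α (`followsStrategies`).

Hence intersections of at most λ open dense sets are open dense. Given an antichain A, let the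
strategy at τ enter dense sets deciding A over every node of level below τ. A node of level at least
α agrees with b α from some point on, so A is decided on it before α; thus A lives below level α and
has size at most λ. A chain of size λ⁺ would yield a large antichain by branching off it. -/

namespace SquareSouslin

open Cardinal Set

theorem mk_Iio_lt_of_toType {c : Cardinal.{u}} (i : c.ord.ToType) : #(Iio i) < c := by
  have := Cardinal.mk_Iio_lt i (by simp)
  simpa using this

/-! ### Cofinality and clubs in a well-order -/

section Cofinality

variable {W : Type u} [ConditionallyCompleteLinearOrderBot W]

/-- `γ` is a limit point of `A`. -/
def AccumulatesAt (A : Set W) (γ : W) : Prop :=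
  ⊥ < γ ∧ ∀ x < γ, ∃ y ∈ A, x < y ∧ y < γ

theorem AccumulatesAt.mono {A B : Set W} {γ : W} (h : AccumulatesAt A γ) (hAB : A ⊆ B) :
    AccumulatesAt B γ :=
  ⟨h.1, fun x hx => let ⟨y, hy, h'⟩ := h.2 x hx; ⟨y, hAB hy, h'⟩⟩

theorem exists_forall_lt_of_card_lt_cof {s : Set W} (h : #s < Order.cof W) :
    ∃ b, ∀ x ∈ s, x < b :=
  not_isCofinal_iff.1 fun hc => (Order.cof_le hc).not_gt h

theorem cof_Iio_le_of_cofinal {M : Set W} {α : W} (h : ∀ x < α, ∃ y ∈ M, x ≤ y ∧ y < α) :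
    Order.cof (Iio α) ≤ #M := by
  have h1 : IsCofinal {y : Iio α | (y : W) ∈ M} := by
    intro x
    obtain ⟨y, hy, hxy, hyα⟩ := h x x.2
    exact ⟨⟨y, hyα⟩, hy, hxy⟩
  refine (Order.cof_le h1).trans ?_
  refine mk_le_of_injective (f := fun y => (⟨y.1.1, y.2⟩ : M)) ?_
  rintro ⟨⟨a, _⟩, _⟩ ⟨⟨b, _⟩, _⟩ hab
  simpa using hab

theorem exists_lt_forall_lt_of_card_lt_cof {ι : Type u} {α : W} {f : ι → W} (hf : ∀ i, f i < α)
    (h : #ι < Order.cof (Iio α)) : ∃ b < α, ∀ i, f i < b := by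
  by_contra! hb
  have := cof_Iio_le_of_cofinal (M := range f) (α := α) fun x hx =>
    let ⟨i, hi⟩ := hb x hx
    ⟨f i, mem_range_self i, hi, hf i⟩
  exact (this.trans mk_range_le).not_gt h

theorem exists_fiber_cofinal {K : Type u} {α : W} (hK : #K < Order.cof (Iio α)) {M : Set W}
    (hM : ∀ x < α, ∃ y ∈ M, x < y ∧ y < α) (c : W → K) :
    ∃ k, ∀ x < α, ∃ y ∈ M, c y = k ∧ x < y ∧ y < α := by
  by_contra! h
  choose f hf hf' using h
  obtain ⟨b, hb, hfb⟩ := exists_lt_forall_lt_of_card_lt_cof hf hK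
  obtain ⟨y, hyM, hby, hyα⟩ := hM b hb
  exact (hf' (c y) y hyM rfl ((hfb _).trans hby)).not_gt hyα

theorem bot_lt_of_cof_ne_zero {α : W} (h : Order.cof (Iio α) ≠ 0) : ⊥ < α := by
  rw [Order.cof_ne_zero_iff] at h
  obtain ⟨x, hx⟩ := h
  exact bot_le.trans_lt hx

theorem exists_between_of_one_lt_cof {α : W} (h : 1 < Order.cof (Iio α)) {x : W} (hx : x < α) :
    ∃ y, x < y ∧ y < α := by
  by_contra! hy
  refine (cof_Iio_le_of_cofinal (M := {x}) (α := α) fun z hz => ⟨x, rfl, ?_, hx⟩).not_gt (by simpa)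
  by_contra! hxz
  exact (hy z hxz).not_gt hz

theorem exists_accumulatesAt_lt {α : W} (hα : ℵ₀ < Order.cof (Iio α)) {A : Set W}
    (hA : ∀ x < α, ∃ y ∈ A, x < y ∧ y < α) {x : W} (hx : x < α) :
    ∃ γ < α, x < γ ∧ AccumulatesAt A γ := by
  choose! f hfA hf hfα using hA
  let s : ℕ → W := fun n => f^[n] x
  have hs : ∀ n, s n < α := by
    intro n
    induction n with
    | zero => exact hx
    | succ n ih => simpa only [s, Function.iterate_succ_apply'] using hfα _ ih
  have hs' : ∀ n, s n < s (n + 1) := by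
    intro n
    simpa only [s, Function.iterate_succ_apply'] using hf _ (hs n)
  obtain ⟨b, hb, hsb⟩ := exists_lt_forall_lt_of_card_lt_cof (ι := ULift.{u} ℕ)
    (f := fun n => s n.down) (fun n => hs _) (by simpa using hα)
  have hbdd : BddAbove (range s) := ⟨b, by rintro _ ⟨n, rfl⟩; exact (hsb ⟨n⟩).le⟩
  have hlt : ∀ n, s n < ⨆ n, s n := fun n => (hs' n).trans_le (le_ciSup hbdd (n + 1))
  refine ⟨⨆ n, s n, (ciSup_le' fun n => (hsb ⟨n⟩).le).trans_lt hb, hlt 0, bot_le.trans_lt (hlt 0),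
    fun y hy => ?_⟩
  obtain ⟨n, hn⟩ := exists_lt_of_lt_ciSup hy
  refine ⟨s (n + 1), ?_, hn.trans (hs' n), hlt _⟩
  simpa only [s, Function.iterate_succ_apply'] using hfA _ (hs n)

end Cofinality

section Club

variable {W : Type u} [ConditionallyCompleteLinearOrderBot W]

theorem mem_of_isClub_of_accumulatesAt {E : Set W} (hE : IsClub E) {γ : W}
    (h : AccumulatesAt E γ) : γ ∈ E := by
  refine hE.isLUB_mem (t := E ∩ Iio γ) inter_subset_left ?_ ⟨fun x hx => hx.2.le, fun b hb => ?_⟩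
  · obtain ⟨y, hy, -, hyγ⟩ := h.2 ⊥ h.1
    exact ⟨y, hy, hyγ⟩
  · by_contra! hbγ
    obtain ⟨y, hy, hby, hyγ⟩ := h.2 b hbγ
    exact (hb ⟨hy, hyγ⟩).not_gt hby

theorem isClub_iInter_of_card_lt_cof [WellFoundedLT W] {ι : Type u} (hω : ℵ₀ < Order.cof W) (hι : #ι < Order.cof W)
    {E : ι → Set W} (hE : ∀ i, IsClub (E i)) : IsClub (⋂ i, E i) :=
  IsClub.iInter hω.ne' (by simpa using hι) hE

theorem isClub_closurePoints [NoMaxOrder W] (hω : ℵ₀ < Order.cof W)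
    (hI : ∀ a : W, #(Iio a) < Order.cof W)
    (f : W → W) : IsClub {a | ∀ b < a, f b < a} := by
  constructor
  · intro t ht _ _ a ha b hb
    obtain ⟨c, hc, hbc⟩ := (lt_isLUB_iff ha).1 hb
    exact (ht hc b hbc).trans_le (ha.1 hc)
  · intro a
    have h1 : ∀ a, ∃ c, a < c ∧ ∀ b < a, f b < c := by
      intro a
      obtain ⟨c, hc⟩ := exists_forall_lt_of_card_lt_cof (s := f '' Iio a)
        (mk_image_le.trans_lt (hI a))
      obtain ⟨d, hd⟩ := exists_gt (max a c)
      exact ⟨d, (le_max_left _ _).trans_lt hd, fun b hb =>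
        (hc _ (mem_image_of_mem f hb)).trans ((le_max_right _ _).trans_lt hd)⟩
    choose g hg hfg using h1
    let s : ℕ → W := fun n => g^[n] a
    have hs : ∀ n, s (n + 1) = g (s n) := fun n => Function.iterate_succ_apply' g n a
    obtain ⟨b, hb⟩ := exists_forall_lt_of_card_lt_cof (s := range s)
      ((mk_le_aleph0_iff.2 (countable_range s).to_subtype).trans_lt hω)
    have hbdd : BddAbove (range s) := ⟨b, fun x hx => (hb x hx).le⟩
    refine ⟨⨆ n, s n, fun x hx => ?_, le_ciSup hbdd 0⟩
    obtain ⟨n, hn⟩ := exists_lt_of_lt_ciSup hx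
    have h2 : f x < s (n + 1) := by rw [hs]; exact hfg _ _ hn
    exact h2.trans_le (le_ciSup hbdd _)

theorem exists_accumulatesAt_cof_eq [WellFoundedLT W] {E : Set W} (hE : IsClub E)
    {θ : Cardinal.{u}} (hθ : θ.IsRegular) (hθW : θ < Order.cof W) :
    ∃ α, AccumulatesAt E α ∧ Order.cof (Iio α) = θ := by
  let I := θ.ord.ToType
  let F : ∀ i : I, (∀ j, j < i → W) → W := fun i ih => sInf {e | e ∈ E ∧ ∀ j (h : j < i), ih j h < e}
  let f : I → W := wellFounded_lt.fix F
  have hf : ∀ i, f i ∈ E ∧ ∀ j < i, f j < f i := by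
    intro i
    have h1 : f i = sInf {e | e ∈ E ∧ ∀ j < i, f j < e} := wellFounded_lt.fix_eq F i
    have h2 : {e | e ∈ E ∧ ∀ j < i, f j < e}.Nonempty := by
      obtain ⟨b, hb⟩ := exists_forall_lt_of_card_lt_cof (s := f '' Iio i)
        (mk_image_le.trans_lt ((mk_Iio_lt_of_toType i).trans hθW))
      obtain ⟨e, he, hbe⟩ := hE.isCofinal b
      exact ⟨e, he, fun j hj => (hb _ (mem_image_of_mem f hj)).trans_le hbe⟩
    have := csInf_mem h2
    rwa [← h1] at this
  have hmono : StrictMono f := fun i j hij => (hf j).2 i hij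
  obtain ⟨b, hb⟩ := exists_forall_lt_of_card_lt_cof (s := range f)
    (mk_range_le.trans_lt (by simpa [I] using hθW))
  have hbdd : BddAbove (range f) := ⟨b, fun x hx => (hb x hx).le⟩
  have : NoMaxOrder I := Cardinal.noMaxOrder hθ.aleph0_le
  have : Nonempty I := by
    rw [← mk_ne_zero_iff]; simpa [I] using hθ.pos.ne'
  have hlt : ∀ i, f i < ⨆ i, f i := fun i =>
    let ⟨j, hj⟩ := exists_gt i
    (hmono hj).trans_le (le_ciSup hbdd j)
  refine ⟨⨆ i, f i, ⟨bot_le.trans_lt (hlt (Classical.arbitrary I)), fun x hx => ?_⟩, ?_⟩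
  · obtain ⟨i, hi⟩ := exists_lt_of_lt_ciSup hx
    exact ⟨f i, (hf i).1, hi, hlt i⟩
  · have h3 := Order.cof_congr_of_strictMono (f := fun i : I => (⟨f i, hlt i⟩ : Iio (⨆ i, f i)))
      (fun i j hij => hmono hij) (by
        intro x
        obtain ⟨i, hi⟩ := exists_lt_of_lt_ciSup x.2
        exact ⟨_, mem_range_self i, hi.le⟩)
    rw [← h3, Ordinal.cof_toType, hθ.cof_ord]

end Club

/-- An infinite set in a well-order contains an infinite increasing sequence, whose images would
descend forever. -/
theorem finite_of_strictAntiOn {ι β : Type*} [LinearOrder ι] [WellFoundedLT ι]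
    [LinearOrder β] [WellFoundedLT β] {s : Set ι} {f : ι → β} (hf : StrictAntiOn f s) :
    s.Finite := by
  by_contra hs
  have : Infinite s := Set.infinite_coe_iff.2 hs
  let e : ℕ ↪ s := Infinite.natEmbedding s
  obtain ⟨g, hg | hg⟩ := exists_increasing_or_nonincreasing_subseq (α := ι) (· > ·) (fun n => (e n : ι))
  · exact (RelEmbedding.natGT (r := ((· < ·) : ι → ι → Prop)) (fun n => (e (g n) : ι))
      fun n => hg n (n + 1) n.lt_succ_self).not_wellFounded wellFounded_lt
  · refine (RelEmbedding.natGT (r := ((· < ·) : β → β → Prop)) (fun n => f (e (g n)))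
      fun n => ?_).not_wellFounded wellFounded_lt
    have h1 := hg n (n + 1) n.lt_succ_self
    refine hf (e _).2 (e _).2 (lt_of_le_of_ne (not_lt.1 h1) fun h => ?_)
    have := g.injective (e.injective (Subtype.ext h))
    omega

end SquareSouslin


/-! ### Coherent ladders and club guessing -/

namespace SquareSouslin

open Cardinal Set

variable {W : Type u} [ConditionallyCompleteLinearOrderBot W]

/-- A coherent assignment of cofinal closed sets `C α ⊆ α`. -/
structure IsCoherentLadder (C : W → Set W) : Prop where
  lt : ∀ ⦃α β⦄, β ∈ C α → β < α
  cofinal : ∀ ⦃α x⦄, x < α → ∃ β ∈ C α, x ≤ β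
  mem : ∀ ⦃α γ⦄, γ < α → AccumulatesAt (C α) γ → γ ∈ C α
  eq : ∀ ⦃α γ⦄, γ < α → AccumulatesAt (C α) γ → C γ = C α ∩ Iio γ

theorem IsCoherentLadder.exists_mem_gt {C : W → Set W} (hC : IsCoherentLadder C) {α : W}
    (hα : 1 < Order.cof (Iio α)) {x : W} (hx : x < α) : ∃ β ∈ C α, x < β ∧ β < α := by
  obtain ⟨y, hxy, hy⟩ := exists_between_of_one_lt_cof hα hx
  obtain ⟨β, hβ, hyβ⟩ := hC.cofinal hy
  exact ⟨β, hβ, hxy.trans_le hyβ, hC.lt hβ⟩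

open Classical in
/-- Round the points of the ladder `C α` down to elements of `E`. -/
noncomputable def ladderTrace (E : Set W) (C : W → Set W) (α : W) : Set W :=
  if AccumulatesAt E α then (fun β => sSup (E ∩ Iic β)) '' {β ∈ C α | (E ∩ Iic β).Nonempty}
  else {β ∈ C α | ∀ e ∈ E, e < α → e ≤ β}

section Rounding

variable {E : Set W} {β e : W}

theorem sSup_inter_Iic_le : sSup (E ∩ Iic β) ≤ β :=
  csSup_le' fun _ hx => hx.2

theorem le_sSup_inter_Iic (he : e ∈ E) (heβ : e ≤ β) : e ≤ sSup (E ∩ Iic β) :=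
  le_csSup ⟨β, fun _ hx => hx.2⟩ ⟨he, heβ⟩

theorem sSup_inter_Iic_mem (hE : IsClub E) (h : (E ∩ Iic β).Nonempty) : sSup (E ∩ Iic β) ∈ E :=
  hE.csSup_mem inter_subset_left h ⟨β, fun _ hx => hx.2⟩

theorem sSup_inter_Iic_eq (he : e ∈ E) : sSup (E ∩ Iic e) = e :=
  sSup_inter_Iic_le.antisymm (le_sSup_inter_Iic he le_rfl)

end Rounding

theorem mk_ladderTrace_le (E : Set W) (C : W → Set W) (α : W) : #(ladderTrace E C α) ≤ #(C α) := by
  unfold ladderTrace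
  split_ifs
  · exact mk_image_le.trans (mk_le_mk_of_subset (sep_subset _ _))
  · exact mk_le_mk_of_subset (sep_subset _ _)

theorem ladderTrace_of_accumulatesAt {E : Set W} {C : W → Set W} {α : W} (h : AccumulatesAt E α) :
    ladderTrace E C α = (fun β => sSup (E ∩ Iic β)) '' {β ∈ C α | (E ∩ Iic β).Nonempty} :=
  if_pos h

theorem ladderTrace_of_not_accumulatesAt {E : Set W} {C : W → Set W} {α : W}
    (h : ¬ AccumulatesAt E α) : ladderTrace E C α = {β ∈ C α | ∀ e ∈ E, e < α → e ≤ β} :=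
  if_neg h

theorem exists_bound_of_not_accumulatesAt {E : Set W} {α : W} (h : ¬ AccumulatesAt E α)
    (hα : ⊥ < α) : ∃ x < α, ∀ e ∈ E, e < α → e ≤ x := by
  simp only [AccumulatesAt, hα, true_and] at h
  push Not at h
  obtain ⟨x, hx, h⟩ := h
  refine ⟨x, hx, fun e he heα => ?_⟩
  by_contra! hxe
  exact (h e he hxe).not_gt heα

/-- A limit of points rounded into E is a limit of E, hence in E, and only ladder points below it
are rounded below it; so coherence is inherited from C. When α is not a limit of E, keeping only the
tail of `C α` past E ensures that its limit points are not limits of E either, so both sides fall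
under the same case. -/
theorem IsCoherentLadder.trace_aux {C : W → Set W} (hC : IsCoherentLadder C) {E : Set W}
    (hE : IsClub E) {α γ : W} (hγα : γ < α) (hγ : AccumulatesAt (ladderTrace E C α) γ) :
    γ ∈ ladderTrace E C α ∧ ladderTrace E C γ = ladderTrace E C α ∩ Iio γ := by
  by_cases hα : AccumulatesAt E α
  · rw [ladderTrace_of_accumulatesAt hα] at hγ ⊢
    have hEγ : AccumulatesAt E γ := hγ.mono <| by
      rintro _ ⟨β, ⟨-, hβ⟩, rfl⟩
      exact sSup_inter_Iic_mem hE hβ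
    have hγE := mem_of_isClub_of_accumulatesAt hE hEγ
    have key : ∀ β, sSup (E ∩ Iic β) < γ → β < γ := by
      intro β h
      by_contra! hβ
      exact (le_sSup_inter_Iic hγE hβ).not_gt h
    have hCγ : AccumulatesAt (C α) γ := by
      refine ⟨hγ.1, fun x hx => ?_⟩
      obtain ⟨_, ⟨β, hβ, rfl⟩, hxβ, hβγ⟩ := hγ.2 x hx
      exact ⟨β, hβ.1, hxβ.trans_le sSup_inter_Iic_le, key β hβγ⟩
    refine ⟨⟨γ, ⟨hC.mem hγα hCγ, γ, hγE, le_rfl⟩, sSup_inter_Iic_eq hγE⟩, ?_⟩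
    rw [ladderTrace_of_accumulatesAt hEγ, hC.eq hγα hCγ]
    ext x
    constructor
    · rintro ⟨β, ⟨⟨h1, h2⟩, h3⟩, rfl⟩
      exact ⟨⟨β, ⟨h1, h3⟩, rfl⟩, (sSup_inter_Iic_le (E := E)).trans_lt h2⟩
    · rintro ⟨⟨β, ⟨h1, h3⟩, rfl⟩, h2⟩
      exact ⟨β, ⟨⟨h1, key β h2⟩, h3⟩, rfl⟩
  · rw [ladderTrace_of_not_accumulatesAt hα] at hγ ⊢
    have hCγ : AccumulatesAt (C α) γ := hγ.mono (sep_subset _ _)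
    obtain ⟨δ, hδ, -, hδγ⟩ := hγ.2 ⊥ hγ.1
    have hEγ : ¬ AccumulatesAt E γ := by
      intro h
      obtain ⟨e, he, hδe, heγ⟩ := h.2 δ hδγ
      exact (hδ.2 e he (heγ.trans hγα)).not_gt hδe
    have hlt : ∀ e ∈ E, e < α → e < γ := fun e he heα => (hδ.2 e he heα).trans_lt hδγ
    refine ⟨⟨hC.mem hγα hCγ, fun e he heα => (hlt e he heα).le⟩, ?_⟩
    rw [ladderTrace_of_not_accumulatesAt hEγ, hC.eq hγα hCγ]
    ext x
    constructor
    · rintro ⟨⟨h1, h2⟩, h3⟩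
      exact ⟨⟨h1, fun e he heα => h3 e he (hlt e he heα)⟩, h2⟩
    · rintro ⟨⟨h1, h2⟩, h3⟩
      exact ⟨⟨h1, h3⟩, fun e he heγ => h2 e he (heγ.trans hγα)⟩

theorem IsCoherentLadder.trace {C : W → Set W} (hC : IsCoherentLadder C) {E : Set W}
    (hE : IsClub E) : IsCoherentLadder (ladderTrace E C) where
  lt α β hβ := by
    unfold ladderTrace at hβ
    split_ifs at hβ
    · obtain ⟨δ, hδ, rfl⟩ := hβ
      exact (sSup_inter_Iic_le (E := E)).trans_lt (hC.lt hδ.1)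
    · exact hC.lt hβ.1
  cofinal α x hx := by
    by_cases hα : AccumulatesAt E α
    · rw [ladderTrace_of_accumulatesAt hα]
      obtain ⟨e, he, hxe, heα⟩ := hα.2 x hx
      obtain ⟨β, hβ, heβ⟩ := hC.cofinal heα
      exact ⟨_, ⟨β, ⟨hβ, e, he, heβ⟩, rfl⟩, hxe.le.trans (le_sSup_inter_Iic he heβ)⟩
    · rw [ladderTrace_of_not_accumulatesAt hα]
      obtain ⟨y, hy, hyE⟩ := exists_bound_of_not_accumulatesAt hα (bot_le.trans_lt hx)
      obtain ⟨β, hβ, hβy⟩ := hC.cofinal (max_lt hx hy)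
      exact ⟨β, ⟨hβ, fun e he heα => (hyE e he heα).trans ((le_max_right _ _).trans hβy)⟩,
        (le_max_left _ _).trans hβy⟩
  mem α γ hγα hγ := (hC.trace_aux hE hγα hγ).1
  eq α γ hγα hγ := (hC.trace_aux hE hγα hγ).2

/-- A value rounded into E that already lies in F does not change when rounding into F ⊆ E instead.
So a club that guesses may be shrunk, and the clubs found for different cofinalities can be
intersected. -/
theorem ladderTrace_subset_of_subset {C : W → Set W} (hC : IsCoherentLadder C) {E F E' : Set W}
    (hE : IsClub E) (hF : IsClub F) (hFE : F ⊆ E) {α : W} (hα : 1 < Order.cof (Iio α))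
    (h : ladderTrace E C α ⊆ E' ∩ F) : ladderTrace F C α ⊆ E' := by
  have hE' := hC.trace hE
  have hacc : AccumulatesAt F α := by
    refine ⟨bot_lt_of_cof_ne_zero (zero_lt_one.trans hα).ne', fun x hx => ?_⟩
    obtain ⟨y, hy, h1⟩ := hE'.exists_mem_gt hα hx
    exact ⟨y, (h hy).2, h1⟩
  rw [ladderTrace_of_accumulatesAt (hacc.mono hFE)] at h
  rw [ladderTrace_of_accumulatesAt hacc]
  rintro _ ⟨β, ⟨hβ, hβF⟩, rfl⟩
  have h1 := h ⟨β, ⟨hβ, hβF.mono (inter_subset_inter_left _ hFE)⟩, rfl⟩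
  have h2 : sSup (F ∩ Iic β) = sSup (E ∩ Iic β) :=
    le_antisymm (le_sSup_inter_Iic (hFE (sSup_inter_Iic_mem hF hβF)) sSup_inter_Iic_le)
      (le_sSup_inter_Iic h1.2 sSup_inter_Iic_le)
  simpa only [h2] using h1.1

variable [WellFoundedLT W]

/-- If every club E were defeated by some G E, iterate `lam` times so that E j ⊆ G (E i) for i < j.
At a limit α of all the E i, each ladder point witnesses defeat at finitely many stages only, and `C
α` has fewer than `lam` points, so some stage is not defeated at α. -/
theorem exists_club_ladderTrace_subset {C : W → Set W} {lam θ : Cardinal.{u}} (hω : ℵ₀ < lam)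
    (hlam : lam < Order.cof W) (hθ : θ.IsRegular) (hθW : θ < Order.cof W)
    (hcard : ∀ α, Order.cof (Iio α) = θ → #(C α) < lam) :
    ∃ E, IsClub E ∧ ∀ E', IsClub E' → ∃ α, Order.cof (Iio α) = θ ∧ ladderTrace E C α ⊆ E' := by
  by_contra! hcon
  have h1 : ∀ E, ∃ E', IsClub E → IsClub E' ∧
      ∀ α, Order.cof (Iio α) = θ → ¬ ladderTrace E C α ⊆ E' := by
    intro E
    by_cases hE : IsClub E
    · obtain ⟨E', h⟩ := hcon E hE
      exact ⟨E', fun _ => h⟩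
    · exact ⟨E, fun h => absurd h hE⟩
  choose G hG using h1
  let L := lam.ord.ToType
  let E : L → Set W := wellFounded_lt.fix fun i ih => ⋂ j : Iio i, G (ih j.1 j.2)
  have hEeq : ∀ i, E i = ⋂ j : Iio i, G (E j) := fun i =>
    wellFounded_lt.fix_eq (fun (i : L) (ih : ∀ j, j < i → Set W) => ⋂ j : Iio i, G (ih j.1 j.2)) i
  have hωW : ℵ₀ < Order.cof W := hω.trans hlam
  have hEclub : ∀ i, IsClub (E i) := by
    intro i
    induction i using WellFoundedLT.induction with
    | ind i ih =>
      rw [hEeq]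
      exact isClub_iInter_of_card_lt_cof hωW ((mk_Iio_lt_of_toType i).trans hlam)
        fun j => (hG _ (ih j j.2)).1
  have hsub : ∀ i j, i < j → E j ⊆ G (E i) := by
    intro i j hij
    rw [hEeq j]
    exact iInter_subset (fun j : Iio j => G (E j)) ⟨i, hij⟩
  have hanti : ∀ i j, i ≤ j → E j ⊆ E i := by
    intro i j hij
    rw [hEeq i]
    exact subset_iInter fun k => hsub k j (k.2.trans_le hij)
  obtain ⟨α, hα, hαθ⟩ := exists_accumulatesAt_cof_eq
    (isClub_iInter_of_card_lt_cof hωW (by simpa [L] using hlam) hEclub) hθ hθW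
  -- Along bad indices the rounded value strictly drops: a later value lies in E j ⊆ G (E i), so it
  -- differs from the earlier bad value.
  let bad : W → Set L := fun β =>
    {i | (E i ∩ Iic β).Nonempty ∧ sSup (E i ∩ Iic β) ∉ G (E i)}
  have hbad : ∀ β, (bad β).Finite := by
    intro β
    refine finite_of_strictAntiOn (f := fun i => sSup (E i ∩ Iic β)) ?_
    intro i hi j hj hij
    have h2 := sSup_inter_Iic_mem (hEclub j) hj.1
    refine lt_of_le_of_ne (le_sSup_inter_Iic (hanti i j hij.le h2) sSup_inter_Iic_le)
      fun h : sSup (E j ∩ Iic β) = sSup (E i ∩ Iic β) => ?_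
    exact hi.2 (h ▸ hsub i j hij h2)
  have hU : #(⋃ β : C α, bad β) < #L := by
    refine (mk_iUnion_le _).trans_lt ?_
    have : #(C α) * ℵ₀ < #L := by
      simpa [L] using mul_lt_of_lt hω.le (hcard α hαθ) hω
    refine (mul_le_mul_right (ciSup_le' fun β => ?_) _).trans_lt this
    exact (hbad β).countable.le_aleph0
  obtain ⟨i, hi⟩ : ∃ i, i ∉ ⋃ β : C α, bad β := by
    by_contra! h
    rw [eq_univ_of_forall h, mk_univ] at hU
    exact lt_irrefl _ hU
  refine (hG (E i) (hEclub i)).2 α hαθ ?_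
  rw [ladderTrace_of_accumulatesAt (hα.mono (iInter_subset _ i))]
  rintro _ ⟨β, ⟨hβ, hne⟩, rfl⟩
  by_contra hβG
  exact hi (mem_iUnion.2 ⟨⟨β, hβ⟩, hne, hβG⟩)

/-- A coherent ladder can be improved to guess clubs at each of at most `lam` many
cofinalities. -/
theorem IsCoherentLadder.exists_club_guessing {C : W → Set W} (hC : IsCoherentLadder C)
    {lam : Cardinal.{u}} (hω : ℵ₀ < lam) (hlam : lam < Order.cof W) {K : Type u} (hK : #K ≤ lam)
    (θ : K → Cardinal.{u})
    (hθ : ∀ k, (θ k).IsRegular) (hθW : ∀ k, θ k < Order.cof W)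
    (hcard : ∀ k α, Order.cof (Iio α) = θ k → #(C α) < lam) :
    ∃ D : W → Set W, IsCoherentLadder D ∧ (∀ α, #(D α) ≤ #(C α)) ∧
      ∀ k E, IsClub E → ∃ α, Order.cof (Iio α) = θ k ∧ D α ⊆ E := by
  have hωW : ℵ₀ < Order.cof W := hω.trans hlam
  choose E hE hEG using fun k =>
    exists_club_ladderTrace_subset hω hlam (hθ k) (hθW k) (hcard k)
  have hF := isClub_iInter_of_card_lt_cof hωW (hK.trans_lt hlam) hE
  refine ⟨ladderTrace (⋂ k, E k) C, hC.trace hF, mk_ladderTrace_le _ _, fun k E' hE' => ?_⟩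
  obtain ⟨α, hα, h⟩ := hEG k (E' ∩ ⋂ k, E k) (hE'.inter hωW.ne' hF)
  refine ⟨α, hα, ladderTrace_subset_of_subset hC (hE k) hF (iInter_subset _ k) ?_ h⟩
  rw [hα]
  exact one_lt_aleph0.trans_le (hθ k).aleph0_le

end SquareSouslin


/-! ### Guessing functions at one cofinality -/

namespace SquareSouslin

open Cardinal Set

variable {W : Type u} [ConditionallyCompleteLinearOrderBot W]

theorem exists_injOn_Iio {lam : Cardinal.{u}} (hI : ∀ a : W, #(Iio a) ≤ lam) (hω : lam ≠ 0)
    (β : W) : ∃ ψ : W → lam.ord.ToType, InjOn ψ (Iio β) := by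
  have h : #(Iio β) ≤ #lam.ord.ToType := by simpa using hI β
  obtain ⟨φ⟩ := h
  have : Nonempty lam.ord.ToType := by rw [← mk_ne_zero_iff]; simpa using hω
  classical
  refine ⟨fun δ => if h : δ < β then φ ⟨δ, h⟩ else Classical.arbitrary _, fun x hx y hy hxy => ?_⟩
  have hx' : x < β := hx
  have hy' : y < β := hy
  simp only [hx', hy', dif_pos] at hxy
  exact congrArg Subtype.val (φ.injective hxy)

/-- Guessing the values of a function `X : W → N` along the ladders of a given cofinality. -/
theorem exists_guess_of_cof_eq [WellFoundedLT W] [NoMaxOrder W] {D : W → Set W} (hD : IsCoherentLadder D)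
    {lam θ : Cardinal.{u}} (hω : ℵ₀ < lam) (hlam : lam < Order.cof W)
    (hI : ∀ a : W, #(Iio a) ≤ lam)
    {K : Type u} (e : K → lam.ord.ToType) (he : ∀ a, ∃ k, a < e k) (hKlam : #K ≤ lam)
    (hθ : θ.IsRegular) (hKθ : #K < θ)
    (hcard : ∀ α, Order.cof (Iio α) = θ → #(D α) < lam)
    (hguess : ∀ E, IsClub E → ∃ α, Order.cof (Iio α) = θ ∧ D α ⊆ E)
    {Q : Set W} (hQ : ∀ α, Order.cof (Iio α) = θ → ∀ x < α, ∃ τ ∈ D α, x < τ ∧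
      AccumulatesAt (D α) τ ∧ τ ∈ Q)
    {N : Type u} {Z : W → K → lam.ord.ToType → N} (hZ : Function.Surjective Z) :
    ∃ g : W → W → N, ∀ (X : W → N) (E : Set W), IsClub E →
      ∃ α, Order.cof (Iio α) = θ ∧ D α ⊆ E ∧ ∀ x < α, ∃ τ ∈ D α, x < τ ∧
        AccumulatesAt (D α) τ ∧ τ ∈ Q ∧ g (sInf (D α ∩ Ioi τ)) τ = X τ := by
  by_contra! hcon
  choose X E hE hXE using hcon
  choose ψ hψ using exists_injOn_Iio hI (aleph0_pos.trans hω).ne'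
  have hωW : ℵ₀ < Order.cof W := hω.trans hlam
  let L := lam.ord.ToType
  -- Candidates are points below β with code below e ζ whose matrix agrees, in row ζ and columns
  -- before j, with Y at τ. The j-th guess reads column j of the least candidate, and Y j is chosen
  -- by recursion as the function defeating that guess.
  let S : K → W → W → L → (L → W → N) → Set W := fun ζ β τ j Y =>
    {δ | δ < β ∧ ψ β δ < e ζ ∧ ∀ i < j, Z δ ζ i = Y i τ}
  let γ : K → L → (L → W → N) → W → W → N := fun ζ j Y β τ => Z (sInf (S ζ β τ j Y)) ζ j
  have hY : ∀ ζ, ∃ Y : L → W → N, ∀ j, Y j = X (γ ζ j Y) := by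
    intro ζ
    let F : ∀ j : L, (∀ i, i < j → W → N) → W → N := fun j ih =>
      X fun β τ => Z (sInf {δ | δ < β ∧ ψ β δ < e ζ ∧ ∀ i (h : i < j), Z δ ζ i = ih i h τ}) ζ j
    exact ⟨wellFounded_lt.fix F, fun j => wellFounded_lt.fix_eq F j⟩
  choose Y hY using hY
  -- The point f τ codes all the defeating values at τ, so it stays a candidate at every stage j
  -- once it is below β with small enough code.
  choose f hf using fun τ => hZ fun ζ j => Y ζ j τ
  have hE' := (isClub_closurePoints hωW (fun a => (hI a).trans_lt hlam) f).inter hωW.ne'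
    (isClub_iInter_of_card_lt_cof (E := fun p : K × L => E (γ p.1 p.2 (Y p.1))) hωW
      (lt_of_le_of_lt (by
        rw [mk_prod, lift_id, lift_id, Cardinal.mk_ord_toType]
        exact (mul_le_mul_left hKlam _).trans (mul_eq_self hω.le).le) hlam) fun p => hE _)
  obtain ⟨α, hα, hDα⟩ := hguess _ hE'
  have hα1 : 1 < Order.cof (Iio α) := by
    rw [hα]; exact one_lt_aleph0.trans_le hθ.aleph0_le
  let nxt : W → W := fun τ => sInf (D α ∩ Ioi τ)
  have hnxt : ∀ τ ∈ D α, nxt τ ∈ D α ∧ τ < nxt τ := by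
    intro τ hτ
    obtain ⟨β, hβ, hτβ, -⟩ := hD.exists_mem_gt hα1 (hD.lt hτ)
    have h : (D α ∩ Ioi τ).Nonempty := ⟨β, hβ, hτβ⟩
    exact csInf_mem h
  have hfn : ∀ τ ∈ D α, f τ < nxt τ := fun τ hτ =>
    (hDα (hnxt τ hτ).1).1 τ (hnxt τ hτ).2
  choose c hc using fun τ => he (ψ (nxt τ) (f τ))
  -- As K is smaller than the cofinality of α, a single ζ bounds the codes of f τ for cofinally many
  -- τ.
  obtain ⟨ζ, hζ⟩ := exists_fiber_cofinal (α := α) (hKθ.trans_eq hα.symm)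
    (M := {τ ∈ D α | AccumulatesAt (D α) τ ∧ τ ∈ Q}) (fun x hx => by
      obtain ⟨τ, hτ, hxτ, h1, h2⟩ := hQ α hα x hx
      exact ⟨τ, ⟨hτ, h1, h2⟩, hxτ, hD.lt hτ⟩) c
  have hmiss : ∀ j : L, ∃ τ ∈ D α, ψ (nxt τ) (f τ) < e ζ ∧
      Z (sInf (S ζ (nxt τ) τ j (Y ζ))) ζ j ≠ Y ζ j τ := by
    intro j
    obtain ⟨x, hx, h⟩ := hXE (γ ζ j (Y ζ)) α hα
      ((hDα.trans inter_subset_right).trans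
        (iInter_subset (fun p : K × L => E (γ p.1 p.2 (Y p.1))) (ζ, j)))
    obtain ⟨τ, ⟨hτ, h1, h2⟩, hcτ, hxτ, -⟩ := hζ x hx
    refine ⟨τ, hτ, hcτ ▸ hc τ, ?_⟩
    have := h τ hτ hxτ h1 h2
    rwa [hY ζ j]
  choose t htD htf htne using hmiss
  have hmem : ∀ j, sInf (S ζ (nxt (t j)) (t j) j (Y ζ)) ∈ S ζ (nxt (t j)) (t j) j (Y ζ) := by
    intro j
    refine csInf_mem ⟨f (t j), hfn _ (htD j), htf j, fun i _ => ?_⟩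
    rw [hf]
  -- For one τ and i < j, the candidate of stage j is right in column i and that of stage i is wrong
  -- there, so their codes differ. This injects `lam` into a set that is too small.
  let Φ : L → D α × Iio (e ζ) := fun j =>
    (⟨t j, htD j⟩, ⟨ψ (nxt (t j)) (sInf (S ζ (nxt (t j)) (t j) j (Y ζ))), (hmem j).2.1⟩)
  have hΦ : Function.Injective Φ := by
    have key : ∀ i j, i < j → Φ i ≠ Φ j := by
      intro i j hij h
      have h1 : t i = t j := congrArg (fun p => (p.1 : W)) h
      have h2 : ψ (nxt (t i)) (sInf (S ζ (nxt (t i)) (t i) i (Y ζ))) =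
        ψ (nxt (t j)) (sInf (S ζ (nxt (t j)) (t j) j (Y ζ))) := congrArg (fun p => (p.2 : L)) h
      have h3 := hmem j
      have h4 := hmem i
      have h5 := htne i
      rw [h1] at h2 h4 h5
      have h6 := hψ _ h4.1 h3.1 h2
      rw [h6] at h5
      exact h5 (h3.2.2 i hij)
    intro i j hij
    by_contra hne
    rcases lt_or_gt_of_ne hne with h | h
    · exact key i j h hij
    · exact key j i h hij.symm
  have h1 := mk_le_of_injective hΦ
  rw [mk_prod, lift_id, lift_id, Cardinal.mk_ord_toType] at h1
  exact h1.not_gt (mul_lt_of_lt hω.le (hcard α hα) (mk_Iio_lt_of_toType _))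

end SquareSouslin


/-! ### Guessing at all cofinalities below `lam` -/

namespace SquareSouslin

open Cardinal Set

variable {W : Type u} [ConditionallyCompleteLinearOrderBot W]

/-- Limit points below `α` of the ladder at `α`. -/
def limitPoints (D : W → Set W) (α : W) : Set W :=
  {τ | τ < α ∧ AccumulatesAt (D α) τ}

theorem IsCoherentLadder.limitPoints_eq {D : W → Set W} (hD : IsCoherentLadder D) {α τ : W}
    (hτ : τ ∈ limitPoints D α) : limitPoints D τ = limitPoints D α ∩ Iio τ := by
  have h : ∀ σ < τ, (AccumulatesAt (D τ) σ ↔ AccumulatesAt (D α) σ) := by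
    intro σ hσ
    rw [hD.eq hτ.1 hτ.2]
    refine ⟨fun h => h.mono inter_subset_left, fun h => ⟨h.1, fun x hx => ?_⟩⟩
    obtain ⟨y, hy, hxy, hyσ⟩ := h.2 x hx
    exact ⟨y, ⟨hy, hyσ.trans hσ⟩, hxy, hyσ⟩
  ext σ
  exact ⟨fun hσ => ⟨⟨hσ.1.trans hτ.1, (h σ hσ.1).1 hσ.2⟩, hσ.1⟩,
    fun hσ => ⟨hσ.2, (h σ hσ.2).2 hσ.1.2⟩⟩

/-- The tail of η past ι has the same cofinality as η, so it cannot be as short as κ.ord + r, whose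
cardinality is below that cofinality. -/
theorem mod_add_lt {η : Ordinal.{u}} {κ : Cardinal.{u}} (hη : ℵ₀ < η.cof) (hκ : κ < η.cof)
    {ι r : Ordinal.{u}} (hι : ι < η) (hr : r < κ.ord) :
    κ.ord * (ι / κ.ord + 1) + r < η := by
  have h1 : κ.ord * (ι / κ.ord + 1) + r ≤ ι + (κ.ord + r) := by
    rw [mul_add_one, add_assoc]
    exact add_le_add_left (Ordinal.mul_div_le _ _) _
  refine h1.trans_lt ?_
  by_contra! h
  obtain ⟨δ, rfl⟩ : ∃ δ, η = ι + δ := ⟨η - ι, (Ordinal.add_sub_cancel_of_le hι.le).symm⟩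
  have hδ : δ ≠ 0 := by
    rintro rfl
    simp at hι
  rw [Ordinal.cof_add _ hδ] at hη hκ
  have h2 : δ ≤ κ.ord + r := by simpa using h
  have h3 : δ.card < δ.cof := by
    refine (Ordinal.card_le_card h2).trans_lt ?_
    rw [Ordinal.card_add, card_ord]
    exact add_lt_of_lt hη.le hκ ((lt_ord.1 hr).trans hκ)
  exact h3.not_ge (Ordinal.cof_le_card δ)

variable [WellFoundedLT W]

/-- Colour the points of `W` so that each colour occurs cofinally often among the limit points of
any ladder of cofinality greater than the number of colours. -/
theorem IsCoherentLadder.exists_coloring {D : W → Set W} (hD : IsCoherentLadder D)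
    (K : Type u) [Nonempty K] :
    ∃ col : W → K, ∀ α, ℵ₀ < Order.cof (Iio α) → #K < Order.cof (Iio α) → ∀ k, ∀ x < α,
      ∃ τ ∈ D α, x < τ ∧ AccumulatesAt (D α) τ ∧ col τ = k := by
  have hE : Nonempty (K ≃ (#K).ord.ToType) := by rw [← Cardinal.eq]; simp
  obtain ⟨ε⟩ := hE
  let idx : K → Ordinal.{u} := fun k => Ordinal.typein (α := (#K).ord.ToType) (· < ·) (ε k)
  have hidx : Function.Injective idx := (Ordinal.typein_injective _).comp ε.injective
  have hidx' : ∀ k, idx k < (#K).ord := fun k => Ordinal.typein_lt_self _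
  -- By coherence, the order type of `limitPoints D τ` is the position of τ among the limit points
  -- of any ladder having τ as a limit point. Taken modulo #K, positions run through every residue
  -- cofinally often.
  refine ⟨fun τ => Function.invFun idx (Ordinal.type (α := limitPoints D τ) (· < ·) % (#K).ord),
    fun α hω hK k x hx => ?_⟩
  let A := limitPoints D α
  have hAcof : ∀ x < α, ∃ y ∈ A, x < y ∧ y < α := by
    intro x hx
    obtain ⟨γ, hγα, hxγ, hγ⟩ := exists_accumulatesAt_lt hω
      (fun x hx => hD.exists_mem_gt (one_lt_aleph0.trans hω) hx) hx
    exact ⟨γ, ⟨hγα, hγ⟩, hxγ, hγα⟩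
  have hcof : (Ordinal.type (α := A) (· < ·)).cof = Order.cof (Iio α) := by
    rw [Ordinal.cof_type]
    refine Order.cof_congr_of_strictMono (f := fun a : A => (⟨a, a.2.1⟩ : Iio α))
      (fun a b hab => hab) fun y => ?_
    obtain ⟨z, hz, hyz, hzα⟩ := hAcof y y.2
    exact ⟨_, ⟨⟨z, hz⟩, rfl⟩, hyz.le⟩
  obtain ⟨y, hy, hxy, -⟩ := hAcof x hx
  let ι := Ordinal.typein (α := A) (· < ·) ⟨y, hy⟩
  have hι := mod_add_lt (κ := #K) (hcof.symm ▸ hω) (hcof.symm ▸ hK) (Ordinal.typein_lt_type (α := A) (· < ·) ⟨y, hy⟩)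
    (hidx' k)
  let τ : A := Ordinal.enum (α := A) (· < ·) ⟨_, hι⟩
  have hτ : Ordinal.typein (α := A) (· < ·) τ = (#K).ord * (ι / (#K).ord + 1) + idx k :=
    Ordinal.typein_enum _ hι
  have hK0 : (#K).ord ≠ 0 := by simp
  have hyτ : (⟨y, hy⟩ : A) < τ := by
    rw [← Ordinal.typein_lt_typein (α := A) (· < ·), hτ]
    exact (Ordinal.lt_mul_succ_div ι hK0).trans_le le_self_add
  refine ⟨τ, hD.mem τ.2.1 τ.2.2, hxy.trans hyτ, τ.2.2, ?_⟩
  have hrank : Ordinal.type (α := limitPoints D τ) (· < ·) =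
      Ordinal.typein (α := A) (· < ·) τ := by
    rw [hD.limitPoints_eq τ.2]
    refine Ordinal.type_eq.2 ⟨⟨⟨fun a => ⟨⟨a, a.2.1⟩, a.2.2⟩, fun a => ⟨a.1.1, a.1.2, a.2⟩,
      fun _ => rfl, fun _ => rfl⟩, Iff.rfl⟩⟩
  beta_reduce
  rw [hrank, hτ, Ordinal.mul_add_mod_self, Ordinal.mod_eq_of_lt (hidx' k)]
  exact Function.leftInverse_invFun hidx k

/-- A coherent ladder that guesses every function `W → N` in every cofinality below `lam`. -/
theorem IsCoherentLadder.exists_guessing [NoMaxOrder W] {C : W → Set W} (hC : IsCoherentLadder C)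
    {lam : Cardinal.{u}} (hlam : lam.IsSingular) (hlamW : lam < Order.cof W)
    (hI : ∀ a : W, #(Iio a) ≤ lam)
    (hcard : ∀ α, lam.ord.cof < Order.cof (Iio α) → #(C α) < lam)
    {N : Type u} [Nonempty N] (hN : #N ^ lam ≤ #W) :
    ∃ (D : W → Set W) (g : W → W → N), IsCoherentLadder D ∧
      ∀ μ < lam, ∀ (X : W → N) (E : Set W), IsClub E →
        ∃ α, μ < Order.cof (Iio α) ∧ lam.ord.cof < Order.cof (Iio α) ∧ D α ⊆ E ∧
          ∀ x < α, ∃ τ ∈ D α, x < τ ∧ AccumulatesAt (D α) τ ∧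
            g (sInf (D α ∩ Ioi τ)) τ = X τ := by
  have hω : ℵ₀ < lam := lt_of_le_of_ne hlam.aleph0_le
    (fun h => not_isSingular_aleph0 (h ▸ hlam))
  let L := lam.ord.ToType
  have : NoMaxOrder L := Cardinal.noMaxOrder hω.le
  obtain ⟨K, hKcof, hK⟩ := Order.exists_cof_eq L
  rw [Ordinal.cof_toType] at hK
  have hL : Nonempty L := by
    rw [← mk_ne_zero_iff]; simpa [L] using (aleph0_pos.trans hω).ne'
  have : Nonempty K := hKcof.nonempty.to_subtype
  have hKlam : #K < lam := hK.trans_lt hlam.cof_ord_lt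
  let e : K → L := Subtype.val
  have he : ∀ a, ∃ k, a < e k := by
    intro a
    obtain ⟨b, hab⟩ := exists_gt a
    obtain ⟨k, hk, hbk⟩ := hKcof b
    exact ⟨⟨k, hk⟩, hab.trans_le hbk⟩
  -- Regular cardinals below `lam`, cofinal in it and above its cofinality, so that the ladders at
  -- these cofinalities have size below `lam`.
  let θ : K → Cardinal.{u} := fun k => Order.succ (max ℵ₀ (max (#K) (#(Iio (e k)))))
  have hθreg : ∀ k, (θ k).IsRegular := fun k => isRegular_succ (le_max_left _ _)
  have hθK : ∀ k, #K < θ k := fun k =>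
    Order.lt_succ_of_le ((le_max_left _ _).trans (le_max_right _ _))
  have hθI : ∀ k, #(Iio (e k)) < θ k := fun k =>
    Order.lt_succ_of_le ((le_max_right _ _).trans (le_max_right _ _))
  have hθω : ∀ k, ℵ₀ < θ k := fun k => Order.lt_succ_of_le (le_max_left _ _)
  have hθlam : ∀ k, θ k < lam := fun k =>
    hlam.isSuccLimit.succ_lt (max_lt hω (max_lt hKlam (mk_Iio_lt_of_toType _)))
  obtain ⟨D, hD, hDC, hDguess⟩ := hC.exists_club_guessing hω hlamW hKlam.le θ hθreg
    (fun k => (hθlam k).trans hlamW) (fun k α hα => hcard α (hα ▸ hK ▸ hθK k))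
  obtain ⟨col, hcol⟩ := hD.exists_coloring K
  have hZ : ∃ Z : W → K → L → N, Function.Surjective Z := by
    have h1 : #(K → L → N) ≤ #W := by
      simp only [← power_def, ← power_mul, L, Cardinal.mk_ord_toType]
      rwa [mul_eq_left hω.le hKlam.le (mk_ne_zero K)]
    obtain ⟨φ⟩ := h1
    exact ⟨Function.invFun φ, Function.invFun_surjective φ.injective⟩
  obtain ⟨Z, hZ⟩ := hZ
  choose g hg using fun k => exists_guess_of_cof_eq hD hω hlamW hI e he hKlam.le (hθreg k) (hθK k)
    (fun α hα => (hDC α).trans_lt (hcard α (hα ▸ hK ▸ hθK k))) (hDguess k) (Q := {τ | col τ = k})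
    (fun α hα => hcol α (hα ▸ hθω k) (hα ▸ hθK k) k) hZ
  refine ⟨D, fun β τ => g (col τ) β τ, hD, fun μ hμ X E hE => ?_⟩
  obtain ⟨k, hk⟩ : ∃ k, μ ≤ #(Iio (e k)) := by
    have h1 : μ.ord < Ordinal.type (α := L) (· < ·) := by simpa [L] using ord_lt_ord.2 hμ
    let a : L := Ordinal.enum (α := L) (· < ·) ⟨_, h1⟩
    have ha : Ordinal.typein (α := L) (· < ·) a = μ.ord := Ordinal.typein_enum _ h1
    obtain ⟨k, hk⟩ := he a
    refine ⟨k, ?_⟩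
    have h2 : #(Iio a) = μ := by
      have := congrArg Ordinal.card ha
      rwa [card_ord] at this
    rw [← h2]
    exact mk_le_mk_of_subset (Iio_subset_Iio hk.le)
  obtain ⟨α, hα, hαE, h⟩ := hg k X E hE
  refine ⟨α, hα ▸ hk.trans_lt (hθI k), hα ▸ hK ▸ hθK k, hαE, fun x hx => ?_⟩
  obtain ⟨τ, hτ, hxτ, h1, h2, h3⟩ := h x hx
  refine ⟨τ, hτ, hxτ, h1, ?_⟩
  have h4 : col τ = k := h2
  beta_reduce
  rw [← h3, h4]

end SquareSouslin


/-! ### Nodes and the branches `b` -/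

namespace SquareSouslin

open Cardinal Set

variable {W : Type u} [ConditionallyCompleteLinearOrderBot W]

/-- `S` is a node of level `a`: it agrees on a final segment with `b γ` at every `γ ≤ a` of
cofinality at least `κ`. -/
structure IsNode (κ : Cardinal.{u}) (b : W → Set W) (a : W) (S : Set W) : Prop where
  subset : S ⊆ Iio a
  agree : ∀ γ ≤ a, κ ≤ Order.cof (Iio γ) → ∃ x < γ, ∀ y, x ≤ y → y < γ → (y ∈ S ↔ y ∈ b γ)

section Node

variable {κ : Cardinal.{u}} {b : W → Set W} {a c : W} {S S' : Set W}

theorem IsNode.restrict (h : IsNode κ b a S) (hca : c ≤ a) : IsNode κ b c (S ∩ Iio c) where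
  subset := inter_subset_right
  agree γ hγ hκ := by
    obtain ⟨x, hx, hxy⟩ := h.agree γ (hγ.trans hca) hκ
    refine ⟨x, hx, fun y h1 h2 => ?_⟩
    rw [← hxy y h1 h2]
    exact ⟨fun h => h.1, fun h => ⟨h, h2.trans_le hγ⟩⟩

/-- Conditions at γ ≤ a see only S; for γ > a the final segment of agreement can be started past a,
where only S' is seen. -/
theorem IsNode.graft (h : IsNode κ b a S) (h' : IsNode κ b c S') (hac : a ≤ c) :
    IsNode κ b c (S ∪ S' \ Iio a) where
  subset := union_subset (h.subset.trans (Iio_subset_Iio hac)) (sdiff_subset.trans h'.subset)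
  agree γ hγ hκ := by
    rcases le_or_gt γ a with hγa | hγa
    · obtain ⟨x, hx, hxy⟩ := h.agree γ hγa hκ
      refine ⟨x, hx, fun y h1 h2 => ?_⟩
      rw [← hxy y h1 h2]
      have : y < a := h2.trans_le hγa
      simp [this]
    · obtain ⟨x, hx, hxy⟩ := h'.agree γ hγ hκ
      refine ⟨max x a, max_lt hx hγa, fun y h1 h2 => ?_⟩
      rw [← hxy y ((le_max_left _ _).trans h1) h2]
      have h3 : a ≤ y := (le_max_right _ _).trans h1
      have h4 : y ∉ S := fun hy => (h.subset hy).not_ge h3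
      simp [h4, h3]

theorem graft_inter (h : S ⊆ Iio a) : (S ∪ S' \ Iio a) ∩ Iio a = S := by
  ext y
  simp only [mem_inter_iff, mem_union, mem_sdiff, mem_Iio]
  exact ⟨fun h' => h'.1.resolve_right fun h'' => h''.2 h'.2, fun h' => ⟨Or.inl h', h h'⟩⟩

theorem IsNode.of_covBy (hκ : 1 < κ) (h : IsNode κ b a S) (hac : a ⋖ c) (hS' : S' ⊆ Iio c)
    (hS : S' ∩ Iio a = S) : IsNode κ b c S' where
  subset := hS'
  agree γ hγ hκγ := by
    rcases hγ.lt_or_eq with hγ | rfl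
    · have hγa : γ ≤ a := not_lt.1 fun h => hac.2 h hγ
      obtain ⟨x, hx, hxy⟩ := h.agree γ hγa hκγ
      refine ⟨x, hx, fun y h1 h2 => ?_⟩
      rw [← hxy y h1 h2, ← hS]
      exact ⟨fun h => ⟨h, h2.trans_le hγa⟩, fun h => h.1⟩
    · refine absurd (hκ.trans_le hκγ) (not_lt.2 ?_)
      refine (cof_Iio_le_of_cofinal (M := {a}) fun x hx => ⟨a, rfl, ?_, hac.1⟩).trans (by simp)
      exact not_lt.1 fun h => hac.2 h hx

theorem IsNode.succ (hκ : 1 < κ) (h : IsNode κ b a S) (hac : a ⋖ c) : IsNode κ b c S :=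
  h.of_covBy hκ hac (h.subset.trans (Iio_subset_Iio hac.le)) (inter_eq_left.2 h.subset)

theorem IsNode.congr {b' : W → Set W} (hb : ∀ γ ≤ a, b γ = b' γ) (h : IsNode κ b a S) :
    IsNode κ b' a S where
  subset := h.subset
  agree γ hγ hκ := by
    rw [← hb γ hγ]
    exact h.agree γ hγ hκ

end Node

open Classical in
/-- The node of level `β` used to continue a branch from `τ`, incorporating the guess `g β τ` if
it is a node. -/
noncomputable def bridge (κ : Cardinal.{u}) (g : W → W → W × Set W) (b : W → Set W) (τ β : W) :
    Set W :=
  if (g β τ).1 < β ∧ IsNode κ b (g β τ).1 (g β τ).2 then (g β τ).2 ∪ b β \ Iio (g β τ).1 else b β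

/-- Concatenate the bridges between consecutive points of the ladder `D α`. -/
def branchStep (κ : Cardinal.{u}) (D : W → Set W) (g : W → W → W × Set W) (b : W → Set W) (α : W) :
    Set W :=
  {x | ∃ β, IsLeast (D α ∩ Ioi x) β ∧ x ∈ bridge κ g b (sSup (D α ∩ Iic x)) β}

section Branch

variable {κ : Cardinal.{u}} {D : W → Set W} {g : W → W → W × Set W} {b : W → Set W}

theorem bridge_congr {b' : W → Set W} {τ β : W} (hb : ∀ γ ≤ β, b γ = b' γ) :
    bridge κ g b τ β = bridge κ g b' τ β := by
  have h1 : (g β τ).1 < β ∧ IsNode κ b (g β τ).1 (g β τ).2 ↔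
      (g β τ).1 < β ∧ IsNode κ b' (g β τ).1 (g β τ).2 :=
    ⟨fun h => ⟨h.1, h.2.congr fun γ hγ => hb γ (hγ.trans h.1.le)⟩,
      fun h => ⟨h.1, h.2.congr fun γ hγ => (hb γ (hγ.trans h.1.le)).symm⟩⟩
  classical
  unfold bridge
  rw [hb β le_rfl]
  exact if_congr h1 rfl rfl

theorem branchStep_congr (hD : ∀ α, D α ⊆ Iio α) {b' : W → Set W} {α : W}
    (hb : ∀ γ < α, b γ = b' γ) : branchStep κ D g b α = branchStep κ D g b' α := by
  ext x
  refine exists_congr fun β => and_congr_right fun hβ => ?_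
  rw [bridge_congr fun γ hγ => hb γ (hγ.trans_lt (hD α hβ.1.1))]

theorem exists_branch [WellFoundedLT W] (hD : ∀ α, D α ⊆ Iio α) :
    ∃ b : W → Set W, ∀ α, b α = branchStep κ D g b α := by
  classical
  -- The default ∅ is never read, since `branchStep` at α consults b only below α.
  let F : ∀ α : W, (∀ β, β < α → Set W) → Set W := fun α ih =>
    branchStep κ D g (fun β => if h : β < α then ih β h else ∅) α
  refine ⟨wellFounded_lt.fix F, fun α => ?_⟩
  rw [wellFounded_lt.fix_eq F α]
  refine branchStep_congr hD fun γ hγ => ?_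
  simp [hγ]

/-- Membership of y depends only on the ladder points around y, and below a limit point γ these are
the same for `D α` and `D γ`. -/
theorem mem_branch_iff_of_accumulatesAt (hD : IsCoherentLadder D)
    (hb : ∀ α, b α = branchStep κ D g b α) {α γ : W} (hγα : γ < α) (hγ : AccumulatesAt (D α) γ)
    {y : W} (hy : y < γ) : y ∈ b α ↔ y ∈ b γ := by
  rw [hb α, hb γ]
  refine exists_congr fun β => ?_
  rw [hD.eq hγα hγ]
  have h1 : D α ∩ Iio γ ∩ Iic y = D α ∩ Iic y := by
    ext z
    simp only [mem_inter_iff, mem_Iio, mem_Iic]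
    exact ⟨fun h => ⟨h.1.1, h.2⟩, fun h => ⟨⟨h.1, h.2.trans_lt hy⟩, h.2⟩⟩
  have h2 : IsLeast (D α ∩ Iio γ ∩ Ioi y) β ↔ IsLeast (D α ∩ Ioi y) β := by
    obtain ⟨δ, hδ, hyδ, hδγ⟩ := hγ.2 y hy
    constructor
    · rintro ⟨⟨⟨h1, h2⟩, h3⟩, h4⟩
      refine ⟨⟨h1, h3⟩, fun z hz => ?_⟩
      rcases lt_or_ge z γ with hzγ | hzγ
      · exact h4 ⟨⟨hz.1, hzγ⟩, hz.2⟩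
      · exact h2.le.trans hzγ
    · rintro ⟨⟨h1, h2⟩, h3⟩
      exact ⟨⟨⟨h1, (h3 ⟨hδ, hyδ⟩).trans_lt hδγ⟩, h2⟩, fun z hz => h3 ⟨hz.1.1, hz.2⟩⟩
  rw [h1, h2]

theorem isNode_bridge {τ β : W} (h : IsNode κ b β (b β)) : IsNode κ b β (bridge κ g b τ β) := by
  unfold bridge
  split_ifs with h1
  · exact h1.2.graft h h1.1.le
  · exact h

/-- At a limit point γ of `D α`, coherence gives agreement with b γ. At any other γ < α, a final
segment of γ lies in one gap of the ladder, where b α is a bridge to some β ≥ γ, a node by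
induction. -/
theorem isNode_branch [WellFoundedLT W] (hκ : 1 < κ) (hD : IsCoherentLadder D)
    (hb : ∀ α, b α = branchStep κ D g b α) (α : W) : IsNode κ b α (b α) := by
  induction α using WellFoundedLT.induction with
  | ind α ih =>
  constructor
  · intro x hx
    rw [hb α] at hx
    obtain ⟨β, hβ, -⟩ := hx
    exact (show x < β from hβ.1.2).trans (hD.lt hβ.1.1)
  · intro γ hγ hκγ
    have hγ0 : ⊥ < γ := bot_lt_of_cof_ne_zero ((zero_lt_one.trans hκ).trans_le hκγ).ne'
    rcases hγ.lt_or_eq with hγα | rfl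
    · by_cases hacc : AccumulatesAt (D α) γ
      · exact ⟨⊥, hγ0, fun y _ hy => mem_branch_iff_of_accumulatesAt hD hb hγα hacc hy⟩
      · obtain ⟨x, hx, hxD⟩ := exists_bound_of_not_accumulatesAt hacc hγ0
        obtain ⟨δ, hδ, hγδ⟩ := hD.cofinal hγα
        have hne : (D α ∩ Ici γ).Nonempty := ⟨δ, hδ, hγδ⟩
        have hβ : IsLeast (D α ∩ Ici γ) (sInf (D α ∩ Ici γ)) :=
          ⟨csInf_mem hne, fun z hz => csInf_le' hz⟩
        set β := sInf (D α ∩ Ici γ)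
        obtain ⟨x', hx', hx'y⟩ :=
          (isNode_bridge (g := g) (τ := sSup (D α ∩ Iic x)) (ih β (hD.lt hβ.1.1))).agree γ hβ.1.2 hκγ
        refine ⟨max x x', max_lt hx hx', fun y hy hyγ => ?_⟩
        have hxy : x ≤ y := (le_max_left _ _).trans hy
        rw [← hx'y y ((le_max_right _ _).trans hy) hyγ, hb α]
        have h1 : D α ∩ Ioi y = D α ∩ Ici γ := by
          ext z
          refine and_congr_right fun hz => ⟨fun h => ?_, fun h => hyγ.trans_le h⟩
          by_contra h2
          exact ((hxD z hz (not_le.1 h2)).trans hxy).not_gt h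
        have h2 : D α ∩ Iic y = D α ∩ Iic x := by
          ext z
          refine and_congr_right fun hz => ⟨fun h => ?_, fun h => le_trans h hxy⟩
          exact hxD z hz (lt_of_le_of_lt h hyγ)
        constructor
        · rintro ⟨β', hβ', hy'⟩
          rw [h1] at hβ'
          rw [h2, hβ'.unique hβ] at hy'
          exact hy'
        · intro hy'
          exact ⟨β, by rwa [h1], by rwa [h2]⟩
    · exact ⟨⊥, hγ0, fun _ _ _ => Iff.rfl⟩

theorem branch_inter_eq_of_guess [WellFoundedLT W] (hD : IsCoherentLadder D)
    (hb : ∀ α, b α = branchStep κ D g b α) {α τ a : W} {t : Set W} (hτD : τ ∈ D α)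
    (hτ : AccumulatesAt (D α) τ) (hg : g (sInf (D α ∩ Ioi τ)) τ = (a, t))
    (hne : (D α ∩ Ioi τ).Nonempty)
    (ha : a < sInf (D α ∩ Ioi τ)) (ht : IsNode κ b a t) (hta : t ∩ Iio τ = b τ ∩ Iio τ) :
    b α ∩ Iio a = t := by
  have hβ : IsLeast (D α ∩ Ioi τ) (sInf (D α ∩ Ioi τ)) :=
    ⟨csInf_mem hne, fun z hz => csInf_le' hz⟩
  set β := sInf (D α ∩ Ioi τ)
  have key : ∀ y < a, y ∈ b α ↔ y ∈ t := by
    intro y hya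
    rcases lt_or_ge y τ with hyτ | hyτ
    · rw [mem_branch_iff_of_accumulatesAt hD hb (hD.lt hτD) hτ hyτ]
      have := Set.ext_iff.1 hta y
      simp only [mem_inter_iff, mem_Iio, hyτ, and_true] at this
      exact this.symm
    · have h1 : D α ∩ Ioi y = D α ∩ Ioi τ := by
        ext z
        refine and_congr_right fun hz => ⟨fun h => lt_of_le_of_lt hyτ h, fun h => ?_⟩
        exact (hya.trans ha).trans_le (hβ.2 ⟨hz, h⟩)
      have h2 : sSup (D α ∩ Iic y) = τ := by
        refine le_antisymm (csSup_le' fun z hz => ?_) (le_csSup ⟨y, fun z hz => hz.2⟩ ⟨hτD, hyτ⟩)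
        by_contra! h
        exact (hya.trans ha).not_ge ((hβ.2 ⟨hz.1, h⟩).trans hz.2)
      have h3 : y ∈ bridge κ g b τ β ↔ y ∈ t := by
        unfold bridge
        rw [hg, if_pos ⟨ha, ht⟩]
        simp [hya]
      rw [← h3, hb α]
      constructor
      · rintro ⟨β', hβ', hy'⟩
        rw [h1] at hβ'
        rwa [h2, hβ'.unique hβ] at hy'
      · intro hy'
        exact ⟨β, by rwa [h1], by rwa [h2]⟩
  ext y
  exact ⟨fun h => (key y h.2).1 h.1, fun h => ⟨(key y (ht.subset h)).2 h, ht.subset h⟩⟩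

end Branch

end SquareSouslin


/-! ### Distributivity, counting nodes and sealing antichains -/

namespace SquareSouslin

open Cardinal Set

variable {W : Type u} [ConditionallyCompleteLinearOrderBot W]

/-- A set of nodes that is upwards closed and dense. -/
structure IsOpenDense (κ : Cardinal.{u}) (b : W → Set W) (U : Set (W × Set W)) : Prop where
  isUpper : ∀ ⦃a S c S'⦄, (a, S) ∈ U → IsNode κ b c S' → a ≤ c → S' ∩ Iio a = S → (c, S') ∈ U
  dense : ∀ ⦃a S⦄, IsNode κ b a S →
    ∃ c S', a ≤ c ∧ IsNode κ b c S' ∧ S' ∩ Iio a = S ∧ (c, S') ∈ U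

/-- For every strategy `X` extending the branches `b τ`, some branch follows `X` cofinally often. -/
def FollowsStrategies (lam κ : Cardinal.{u}) (b : W → Set W) : Prop :=
  ∀ μ < lam, ∀ X : W → W × Set W, (∀ τ, IsNode κ b (X τ).1 (X τ).2) → (∀ τ, τ < (X τ).1) →
    (∀ τ, (X τ).2 ∩ Iio τ = b τ) → ∃ α, μ < Order.cof (Iio α) ∧ κ < Order.cof (Iio α) ∧
      ∃ M : Set W, (∀ x < α, ∃ τ ∈ M, x < τ ∧ τ < α) ∧
        (∀ τ ∈ M, (X τ).1 < α ∧ b α ∩ Iio (X τ).1 = (X τ).2) ∧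
        ∀ τ ∈ M, ∀ τ' ∈ M, τ < τ' → (X τ).1 ≤ τ'

section Distributivity

variable {κ lam : Cardinal.{u}} {b : W → Set W}

theorem inter_Iio_inter_Iio {S : Set W} {a c : W} (h : a ≤ c) : S ∩ Iio c ∩ Iio a = S ∩ Iio a := by
  rw [inter_assoc, inter_eq_right.2 (Iio_subset_Iio h)]

theorem graft_graft {S Y z : Set W} {a m : W} (ham : a ≤ m) (hS : S ⊆ Iio a)
    (hz : z ∩ Iio m = S ∪ Y \ Iio a) (hY : Y ⊆ Iio m) : S ∪ (Y ∪ z \ Iio m) \ Iio a = z := by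
  ext w
  rcases lt_or_ge w m with hw | hw
  · have h := Set.ext_iff.1 hz w
    simp only [mem_inter_iff, mem_Iio, hw, and_true] at h
    rw [h]
    simp [hw]
  · have h1 : w ∉ S := fun h => (hS h).not_ge (ham.trans hw)
    have h2 : w ∉ Y := fun h => (hY h).not_ge hw
    simp [h1, h2, hw, ham.trans hw]

/-- The strategy at τ enters some U j that b τ has not yet met. If the followed b α missed one of
the sets, every move along it would enter a new U j, giving at least cof α > #I indices. -/
theorem exists_branch_mem_of_card_lt [WellFoundedLT W] [NoMaxOrder W] (hκ : 1 < κ)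
    (hb : ∀ α, IsNode κ b α (b α)) (hF : FollowsStrategies lam κ b)
    {I : Type u} (hI : #I < lam) {U : I → Set (W × Set W)} (hU : ∀ i, IsOpenDense κ b (U i)) :
    ∃ α, ∀ i, (α, b α) ∈ U i := by
  have hX : ∀ τ, ∃ p : W × Set W, ∃ i : Option I, IsNode κ b p.1 p.2 ∧ τ < p.1 ∧
      p.2 ∩ Iio τ = b τ ∧ ((∃ i, (τ, b τ) ∉ U i) → ∃ j ∈ i, (τ, b τ) ∉ U j ∧ p ∈ U j) := by
    intro τ
    by_cases h : ∃ i, (τ, b τ) ∉ U i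
    · obtain ⟨i, hi⟩ := h
      obtain ⟨c, S', hc, hS', hSτ, hU'⟩ := (hU i).dense (hb τ)
      refine ⟨(c, S'), some i, hS', lt_of_le_of_ne hc ?_, hSτ, fun _ => ⟨i, rfl, hi, hU'⟩⟩
      rintro rfl
      rw [inter_eq_left.2 hS'.subset] at hSτ
      exact hi (hSτ ▸ hU')
    -- With nothing left to meet, one successor step keeps the move legal.
    · obtain ⟨c, hc⟩ := exists_covBy_of_wellFoundedLT (not_isMax τ)
      exact ⟨(c, b τ), none, (hb τ).succ hκ hc, hc.1, inter_eq_left.2 (hb τ).subset,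
        fun h' => absurd h' h⟩
  choose X i hX1 hX2 hX3 hXi using hX
  obtain ⟨α, hα, -, M, hM, hMα, hMM⟩ := hF _ hI X hX1 hX2 hX3
  refine ⟨α, ?_⟩
  by_contra! hcon
  obtain ⟨i₀, hi₀⟩ := hcon
  have hbτ : ∀ τ ∈ M, b α ∩ Iio τ = b τ := by
    intro τ hτ
    rw [← hX3 τ, ← (hMα τ hτ).2, inter_Iio_inter_Iio (hX2 τ).le]
  have hτα : ∀ τ ∈ M, τ < α := fun τ hτ => (hX2 τ).trans (hMα τ hτ).1
  have hun : ∀ τ : M, ∃ j ∈ i τ, ((τ : W), b τ) ∉ U j ∧ X τ ∈ U j := fun τ =>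
    hXi τ ⟨i₀, fun h => hi₀ ((hU i₀).isUpper h (hb α) (hτα τ τ.2).le (hbτ τ τ.2))⟩
  choose j hj hj1 hj2 using hun
  have key : ∀ τ τ' : M, (τ : W) < τ' → j τ ≠ j τ' := by
    intro τ τ' h hjj
    refine hj1 τ' (hjj ▸ (hU (j τ)).isUpper (hj2 τ) (hb τ') (hMM τ τ.2 τ' τ'.2 h) ?_)
    rw [← hbτ τ' τ'.2, inter_Iio_inter_Iio (hMM τ τ.2 τ' τ'.2 h), (hMα τ τ.2).2]
  have hinj : Function.Injective j := by
    intro τ τ' h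
    by_contra hne
    rcases lt_or_gt_of_ne (fun h => hne (Subtype.ext h) : (τ : W) ≠ τ') with h' | h'
    · exact key _ _ h' h
    · exact key _ _ h' h.symm
  refine hα.not_ge ((cof_Iio_le_of_cofinal fun x hx => ?_).trans (mk_le_of_injective hinj))
  obtain ⟨τ, hτ, h1, h2⟩ := hM x hx
  exact ⟨τ, hτ, h1.le, h2⟩

/-- For density, climb above level a, replace the part below a by S, enter U, and transplant the new
tail back onto the original node. -/
theorem IsOpenDense.translate (hb : ∀ α, IsNode κ b α (b α)) {U : Set (W × Set W)}
    (hU : IsOpenDense κ b U) {a : W} {S : Set W} (hS : IsNode κ b a S) :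
    IsOpenDense κ b {p | a ≤ p.1 ∧ IsNode κ b p.1 p.2 ∧ (p.1, S ∪ p.2 \ Iio a) ∈ U} where
  isUpper d y d' y' hy hy' hdd' hyy' := by
    refine ⟨hy.1.trans hdd', hy', hU.isUpper hy.2.2 (hS.graft hy' (hy.1.trans hdd')) hdd' ?_⟩
    have h1 : S ⊆ Iio d := hS.subset.trans (Iio_subset_Iio hy.1)
    rw [← hyy', union_inter_distrib_right, inter_eq_left.2 h1]
    congr 1
    ext z
    simp only [mem_inter_iff, mem_sdiff]
    tauto
  dense d y hy := by
    have h1 := hy.graft (hb (max a d)) (le_max_right _ _)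
    obtain ⟨e, z, hde, hz, hz1, hzU⟩ := hU.dense (hS.graft h1 (le_max_left a d))
    have h2 := h1.graft hz hde
    have hae : a ≤ e := (le_max_left a d).trans hde
    have h3 : S ∪ ((y ∪ b (max a d) \ Iio d) ∪ z \ Iio (max a d)) \ Iio a = z :=
      graft_graft (le_max_left _ _) hS.subset hz1 h1.subset
    refine ⟨e, _, (le_max_right _ _).trans hde, h2, ?_, hae, h2, by rwa [h3]⟩
    rw [← inter_Iio_inter_Iio (le_max_right a d), graft_inter h1.subset, graft_inter hy.subset]

theorem IsOpenDense.iInter_of_card_lt [WellFoundedLT W] [NoMaxOrder W] (hκ : 1 < κ)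
    (hb : ∀ α, IsNode κ b α (b α)) (hF : FollowsStrategies lam κ b)
    {I : Type u} (hI : #I < lam) {U : I → Set (W × Set W)} (hU : ∀ i, IsOpenDense κ b (U i)) :
    IsOpenDense κ b (⋂ i, U i) where
  isUpper a S c S' h h1 h2 h3 :=
    mem_iInter.2 fun i => (hU i).isUpper (mem_iInter.1 h i) h1 h2 h3
  dense a S hS := by
    cases isEmpty_or_nonempty I with
    | inl _ => exact ⟨a, S, le_rfl, hS, inter_eq_left.2 hS.subset, by simp⟩
    | inr hne =>
      obtain ⟨α, hα⟩ := exists_branch_mem_of_card_lt hκ hb hF hI fun i => (hU i).translate hb hS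
      have haα : a ≤ α := (hα (Classical.arbitrary I)).1
      exact ⟨α, _, haα, hS.graft (hb α) haα, graft_inter hS.subset,
        mem_iInter.2 fun i => (hα i).2.2⟩

/-- By singularity, `lam` splits into fewer than `lam` blocks of size below `lam`; the smaller case
applies to each block and then to the blocks. -/
theorem IsOpenDense.iInter_of_card_le [WellFoundedLT W] [NoMaxOrder W] (hlam : lam.IsSingular)
    (hκ : 1 < κ)
    (hb : ∀ α, IsNode κ b α (b α)) (hF : FollowsStrategies lam κ b)
    {I : Type u} (hI : #I ≤ lam) {U : I → Set (W × Set W)} (hU : ∀ i, IsOpenDense κ b (U i)) :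
    IsOpenDense κ b (⋂ i, U i) := by
  let L := lam.ord.ToType
  have : NoMaxOrder L := Cardinal.noMaxOrder hlam.aleph0_le
  obtain ⟨K, hKcof, hK⟩ := Order.exists_cof_eq L
  rw [Ordinal.cof_toType] at hK
  have hIL : #I ≤ #L := by simpa [L] using hI
  obtain ⟨φ⟩ := hIL
  have h1 : ∀ k : K, IsOpenDense κ b (⋂ i : {i // φ i < k}, U i) := by
    intro k
    refine IsOpenDense.iInter_of_card_lt hκ hb hF ?_ fun i => hU i
    refine lt_of_le_of_lt ?_ (mk_Iio_lt_of_toType (k : L))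
    exact mk_le_of_injective (f := fun i : {i // φ i < k} => (⟨φ i, i.2⟩ : Iio (k : L)))
      fun i j hij => Subtype.ext (φ.injective (congrArg Subtype.val hij))
  have h2 : ⋂ i, U i = ⋂ k : K, ⋂ i : {i // φ i < k}, U i := by
    refine subset_antisymm
      (subset_iInter fun k => subset_iInter fun i => iInter_subset _ (i : I)) ?_
    refine subset_iInter fun i => ?_
    obtain ⟨c, hc⟩ := exists_gt (φ i)
    obtain ⟨k, hk, hck⟩ := hKcof c
    exact (iInter_subset _ (⟨k, hk⟩ : K)).trans
      (iInter_subset (fun i : {i // φ i < k} => U i) ⟨i, hc.trans_le hck⟩)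
  rw [h2]
  exact IsOpenDense.iInter_of_card_lt hκ hb hF (hK.trans_lt hlam.cof_ord_lt) h1

end Distributivity

section Counting

variable {κ lam : Cardinal.{u}} {b : W → Set W}

/-- At cofinality at least κ, a node is determined by a proper initial part and b a. At smaller
cofinality it is determined by its restrictions to a short cofinal set, and lam ^ μ ≤ lam applies.
-/
theorem mk_setOf_isNode_le [WellFoundedLT W] (hω : ℵ₀ ≤ lam) (hI : ∀ a : W, #(Iio a) ≤ lam)
    (hpow : ∀ μ < κ, lam ^ μ ≤ lam) (a : W) : #{S | IsNode κ b a S} ≤ lam := by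
  induction a using WellFoundedLT.induction with
  | ind a ih =>
  rcases le_or_gt κ (Order.cof (Iio a)) with hκ | hκ
  · have h1 : ∀ S : {S | IsNode κ b a S}, ∃ x < a, ∀ y, x ≤ y → y < a → (y ∈ S.1 ↔ y ∈ b a) :=
      fun S => S.2.agree a le_rfl hκ
    choose x hx hxS using h1
    let φ : {S | IsNode κ b a S} → Σ c : Iio a, {S | IsNode κ b c S} :=
      fun S => ⟨⟨x S, hx S⟩, ⟨S ∩ Iio (x S), S.2.restrict (hx S).le⟩⟩
    have hφ : Function.Injective φ := by
      have hr : ∀ S : {S | IsNode κ b a S}, (S : Set W) = (φ S).2.1 ∪ (b a ∩ Iio a) \ Iio ((φ S).1 : W) := by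
        intro S
        ext y
        have h1 := hxS S y
        have h2 : y ∈ (S : Set W) → y < a := fun h => S.2.subset h
        simp only [φ, mem_union, mem_inter_iff, mem_sdiff, mem_Iio, not_lt]
        rcases lt_or_ge y (x S) with h3 | h3
        · simp [h3, h3.not_ge]
        · simp only [h3.not_gt, h3, and_false, and_true, false_or]
          exact ⟨fun h => ⟨(h1 h3 (h2 h)).1 h, h2 h⟩, fun h => (h1 h3 h.2).2 h.1⟩
      intro S S' h
      apply Subtype.ext
      rw [hr S, hr S', h]
    refine (mk_le_of_injective hφ).trans ?_
    rw [mk_sigma]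
    refine (sum_le_sum (fun c : Iio a => #{S | IsNode κ b c.1 S}) (fun _ => lam) fun c => ih c c.2).trans ?_
    rw [sum_const, lift_id, lift_id]
    exact mul_le_of_le hω (hI a) le_rfl
  · obtain ⟨M, hMcof, hM⟩ := Order.exists_cof_eq (Iio a)
    -- The extra bit records whether m itself belongs, which matters when a is a successor and m is
    -- its top point.
    let φ : {S | IsNode κ b a S} → ∀ m : M, {S | IsNode κ b m.1 S} × ULift.{u} Prop :=
      fun S m => (⟨S ∩ Iio m.1, S.2.restrict m.1.2.le⟩, ⟨(m : W) ∈ (S : Set W)⟩)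
    have hφ : Function.Injective φ := by
      have key : ∀ S S' : {S | IsNode κ b a S}, φ S = φ S' → (S : Set W) ⊆ S' := by
        intro S S' h y hy
        obtain ⟨m, hm, hym⟩ := hMcof ⟨y, S.2.subset hy⟩
        have h1 := congrFun h ⟨m, hm⟩
        have h2 : (S : Set W) ∩ Iio (m : W) = (S' : Set W) ∩ Iio (m : W) :=
          congrArg (fun p => (p.1 : Set W)) h1
        have h3 : ((m : W) ∈ (S : Set W)) = ((m : W) ∈ (S' : Set W)) :=
          congrArg (fun p => p.2.down) h1
        rcases (show y ≤ m from hym).lt_or_eq with h | h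
        · exact (h2.subset ⟨hy, h⟩).1
        · rw [h] at hy ⊢
          exact h3 ▸ hy
      intro S S' h
      exact Subtype.ext ((key S S' h).antisymm (key S' S h.symm))
    refine (mk_le_of_injective hφ).trans ?_
    rw [mk_pi]
    refine (prod_le_prod _ (fun _ => lam) fun m => ?_).trans ?_
    · rw [mk_prod, lift_id, lift_id]
      refine mul_le_of_le hω (ih m.1 m.1.2) ?_
      refine le_trans ?_ hω
      simp
    · rw [prod_const, lift_id, lift_id]
      exact hpow _ (hM.trans_lt hκ)

theorem mk_nodes_below_le [WellFoundedLT W] (hω : ℵ₀ ≤ lam) (hI : ∀ a : W, #(Iio a) ≤ lam)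
    (hpow : ∀ μ < κ, lam ^ μ ≤ lam) (α : W) :
    #{p : W × Set W | p.1 < α ∧ IsNode κ b p.1 p.2} ≤ lam := by
  let φ : {p : W × Set W | p.1 < α ∧ IsNode κ b p.1 p.2} → Σ c : Iio α, {S | IsNode κ b c S} :=
    fun p => ⟨⟨p.1.1, p.2.1⟩, ⟨p.1.2, p.2.2⟩⟩
  have hφ : Function.Injective φ := by
    refine Function.LeftInverse.injective (g := fun q => ⟨(q.1.1, q.2.1), q.1.2, q.2.2⟩) ?_
    intro p
    rfl
  refine (mk_le_of_injective hφ).trans ?_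
  rw [mk_sigma]
  refine (sum_le_sum (fun c : Iio α => #{S | IsNode κ b c.1 S}) (fun _ => lam) fun c => mk_setOf_isNode_le hω hI hpow c).trans ?_
  rw [sum_const, lift_id, lift_id]
  exact mul_le_of_le hω (hI α) le_rfl

end Counting

section Sealing

variable {κ lam : Cardinal.{u}} {b : W → Set W}

theorem isOpenDense_seal {A : Set (W × Set W)}
    (hA : ∀ p ∈ A, IsNode κ b p.1 p.2) :
    IsOpenDense κ b {p | IsNode κ b p.1 p.2 ∧ ((∃ q ∈ A, q.1 ≤ p.1 ∧ p.2 ∩ Iio q.1 = q.2) ∨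
      ∀ q ∈ A, p.1 ≤ q.1 → q.2 ∩ Iio p.1 ≠ p.2)} where
  isUpper a S c S' := by
    rintro ⟨-, h⟩ hS' hac rfl
    refine ⟨hS', h.imp ?_ ?_⟩
    · rintro ⟨q, hq, hqa, h⟩
      exact ⟨q, hq, le_trans hqa hac, by rw [← h, inter_Iio_inter_Iio hqa]⟩
    · intro h q hq hcq hqc
      refine h q hq (hac.trans hcq) ?_
      dsimp only at hqc ⊢
      rw [← hqc, inter_Iio_inter_Iio hac]
  dense a S hS := by
    by_cases h : ∀ q ∈ A, a ≤ q.1 → q.2 ∩ Iio a ≠ S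
    · exact ⟨a, S, le_rfl, hS, inter_eq_left.2 hS.subset, hS, Or.inr h⟩
    · push Not at h
      obtain ⟨q, hq, haq, hqS⟩ := h
      exact ⟨q.1, q.2, haq, hA q hq, hqS, hA q hq,
        Or.inl ⟨q, hq, le_rfl, inter_eq_left.2 (hA q hq).subset⟩⟩

/-- The strategy moves b τ to where A is decided after grafting any node of level below τ. Where it
is followed, at α, no element of A can have level α or more. -/
theorem mk_antichain_le [WellFoundedLT W] [NoMaxOrder W] (hlam : lam.IsSingular)
    (hI : ∀ a : W, #(Iio a) ≤ lam) (hκ : 1 < κ) (hpow : ∀ μ < κ, lam ^ μ ≤ lam)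
    (hb : ∀ α, IsNode κ b α (b α)) (hF : FollowsStrategies lam κ b) {A : Set (W × Set W)}
    (hA : ∀ p ∈ A, IsNode κ b p.1 p.2)
    (hanti : ∀ p ∈ A, ∀ q ∈ A, p.1 < q.1 → q.2 ∩ Iio p.1 ≠ p.2) : #A ≤ lam := by
  let U : ∀ τ : W, {p : W × Set W | p.1 < τ ∧ IsNode κ b p.1 p.2} → Set (W × Set W) := fun τ x =>
    {p | x.1.1 ≤ p.1 ∧ IsNode κ b p.1 p.2 ∧ (p.1, x.1.2 ∪ p.2 \ Iio x.1.1) ∈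
      {p : W × Set W | IsNode κ b p.1 p.2 ∧ ((∃ q ∈ A, q.1 ≤ p.1 ∧ p.2 ∩ Iio q.1 = q.2) ∨
      ∀ q ∈ A, p.1 ≤ q.1 → q.2 ∩ Iio p.1 ≠ p.2)}}
  have hU : ∀ τ, IsOpenDense κ b (⋂ x, U τ x) := fun τ =>
    IsOpenDense.iInter_of_card_le hlam hκ hb hF
      (mk_nodes_below_le hlam.aleph0_le hI hpow τ)
      fun x => (isOpenDense_seal hA).translate hb x.2.2
  have hX : ∀ τ, ∃ p : W × Set W, IsNode κ b p.1 p.2 ∧ τ < p.1 ∧ p.2 ∩ Iio τ = b τ ∧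
      p ∈ ⋂ x, U τ x := by
    intro τ
    -- Density may be met without climbing, so the search starts from the successor of τ to make the
    -- move strict.
    obtain ⟨c, hc⟩ := exists_covBy_of_wellFoundedLT (not_isMax τ)
    obtain ⟨d, S, hcd, hS, hSc, hSU⟩ := (hU τ).dense ((hb τ).succ hκ hc)
    refine ⟨(d, S), hS, hc.1.trans_le hcd, ?_, hSU⟩
    rw [← inter_Iio_inter_Iio hc.le, hSc, inter_eq_left.2 (hb τ).subset]
  choose X hX1 hX2 hX3 hXU using hX
  obtain ⟨α, -, hα, M, hM, hMα, -⟩ := hF 0 (aleph0_pos.trans_le hlam.aleph0_le) X hX1 hX2 hX3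
  suffices h : A ⊆ {p : W × Set W | p.1 < α ∧ IsNode κ b p.1 p.2} from
    (mk_le_mk_of_subset h).trans (mk_nodes_below_le hlam.aleph0_le hI hpow α)
  suffices h : ∀ p ∈ A, p.1 < α from fun p hp => ⟨h p hp, hA p hp⟩
  intro p hp
  by_contra! hpα
  -- Past x, p agrees with b α. For a followed τ > x, grafting p ∩ x onto X τ therefore gives a
  -- restriction of p, which is decided. As p ∈ A extends it, it must extend a lower element of A,
  -- against `hanti`.
  obtain ⟨x, hx, hxb⟩ := (hA p hp).agree α hpα hα.le
  obtain ⟨τ, hτ, hxτ, -⟩ := hM x hx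
  obtain ⟨hXα, hbX⟩ := hMα τ hτ
  have hnode := (hA p hp).restrict (hx.le.trans hpα)
  obtain ⟨-, -, -, h⟩ := mem_iInter.1 (hXU τ) ⟨(x, p.2 ∩ Iio x), hxτ, hnode⟩
  have heq : p.2 ∩ Iio x ∪ (X τ).2 \ Iio x = p.2 ∩ Iio (X τ).1 := by
    rw [← hbX]
    ext y
    have h1 := hxb y
    have h2 : y < (X τ).1 → y < α := fun h => h.trans hXα
    have h3 : y < x → y < (X τ).1 := fun h => h.trans (hxτ.trans (hX2 τ))
    simp only [mem_union, mem_inter_iff, mem_sdiff, mem_Iio, not_lt]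
    rcases lt_or_ge y x with h4 | h4
    · simp [h4, h3 h4, h4.not_ge]
    · simp only [h4.not_gt, h4, and_false, and_true, false_or]
      exact ⟨fun h => ⟨(h1 h4 (h2 h.2)).2 h.1, h.2⟩, fun h => ⟨(h1 h4 (h2 h.2)).1 h.1, h.2⟩⟩
  dsimp only at h
  rw [heq] at h
  rcases h with ⟨q, hq, hqX, hpq⟩ | h
  · refine hanti q hq p hp ((hqX.trans_lt hXα).trans_le hpα) ?_
    rw [← hpq, inter_Iio_inter_Iio hqX]
  · exact h p hp (hXα.le.trans hpα) rfl

end Sealing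

end SquareSouslin


/-! ### The tree and its properties -/

namespace SquareSouslin

open Cardinal Set

variable {W : Type u} [ConditionallyCompleteLinearOrderBot W]

/-- Ladders inside the closure points of the level map make each move from a ladder point end before
the next one; this lets `bridge` accept correct guesses and keeps successive moves from overlapping.
-/
theorem followsStrategies [WellFoundedLT W] [NoMaxOrder W] {lam κ : Cardinal.{u}} (hκ : 1 < κ)
    (hωW : ℵ₀ < Order.cof W)
    (hI : ∀ a : W, #(Iio a) < Order.cof W)
    {D : W → Set W} (hD : IsCoherentLadder D)
    {g : W → W → {p : W × Set W // p.2 ⊆ Iio p.1}} {b : W → Set W}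
    (hb : ∀ α, b α = branchStep κ D (fun β τ => (g β τ).1) b α)
    (hg : ∀ μ < lam, ∀ (X : W → {p : W × Set W // p.2 ⊆ Iio p.1}) (E : Set W), IsClub E →
        ∃ α, μ < Order.cof (Iio α) ∧ κ < Order.cof (Iio α) ∧ D α ⊆ E ∧
          ∀ x < α, ∃ τ ∈ D α, x < τ ∧ AccumulatesAt (D α) τ ∧
            g (sInf (D α ∩ Ioi τ)) τ = X τ) : FollowsStrategies lam κ b := by
  intro μ hμ X hX1 hX2 hX3
  obtain ⟨α, h1, h2, hDE, hα⟩ := hg μ hμ (fun τ => ⟨X τ, (hX1 τ).subset⟩) _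
    (isClub_closurePoints hωW hI fun τ => (X τ).1)
  have hb' := isNode_branch hκ hD hb
  refine ⟨α, h1, h2, {τ ∈ D α | AccumulatesAt (D α) τ ∧ (g (sInf (D α ∩ Ioi τ)) τ).1 = X τ},
    fun x hx => ?_, ?_, ?_⟩
  · obtain ⟨τ, hτ, hxτ, hacc, hgτ⟩ := hα x hx
    exact ⟨τ, ⟨hτ, hacc, congrArg Subtype.val hgτ⟩, hxτ, hD.lt hτ⟩
  · rintro τ ⟨hτ, hacc, hgτ⟩
    obtain ⟨β, hβ, hτβ, -⟩ := hD.exists_mem_gt (hκ.trans h2) (hD.lt hτ)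
    have hne : (D α ∩ Ioi τ).Nonempty := ⟨β, hβ, hτβ⟩
    have hmem := csInf_mem hne
    have hlt : (X τ).1 < sInf (D α ∩ Ioi τ) := hDE hmem.1 τ hmem.2
    refine ⟨hlt.trans (hD.lt hmem.1), branch_inter_eq_of_guess hD hb hτ hacc hgτ hne hlt (hX1 τ) ?_⟩
    rw [hX3, inter_eq_left.2 (hb' τ).subset]
  · rintro τ - τ' ⟨hτ', -, -⟩ h
    exact (hDE hτ' τ h).le

/-- The nodes of the tree determined by the branches `b`. -/
@[ext]
structure TreeNode (κ : Cardinal.{u}) (b : W → Set W) : Type u where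
  /-- The level of the node. -/
  level : W
  /-- The underlying set of the node. -/
  carrier : Set W
  isNode : IsNode κ b level carrier

namespace TreeNode

variable {κ : Cardinal.{u}} {b : W → Set W}

instance : PartialOrder (TreeNode κ b) where
  le p q := p.level ≤ q.level ∧ q.carrier ∩ Iio p.level = p.carrier
  le_refl p := ⟨le_rfl, inter_eq_left.2 p.isNode.subset⟩
  le_trans p q r h h' := ⟨h.1.trans h'.1, by rw [← h.2, ← h'.2, inter_Iio_inter_Iio h.1]⟩
  le_antisymm p q h h' := by
    have h1 : p.level = q.level := h.1.antisymm h'.1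
    refine TreeNode.ext h1 ?_
    rw [← h.2, h1, inter_eq_left.2 q.isNode.subset]

theorem le_iff {p q : TreeNode κ b} : p ≤ q ↔ p.level ≤ q.level ∧ q.carrier ∩ Iio p.level = p.carrier :=
  Iff.rfl

theorem lt_iff {p q : TreeNode κ b} : p < q ↔ p.level < q.level ∧ q.carrier ∩ Iio p.level = p.carrier := by
  rw [lt_iff_le_not_ge, le_iff, le_iff]
  constructor
  · rintro ⟨⟨h1, h2⟩, h3⟩
    refine ⟨lt_of_le_of_ne h1 fun h => h3 ⟨h.ge, ?_⟩, h2⟩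
    rw [← h2, h, inter_Iio_inter_Iio le_rfl, inter_eq_left.2 q.isNode.subset]
  · rintro ⟨h1, h2⟩
    exact ⟨⟨h1.le, h2⟩, fun h => h.1.not_gt h1⟩

/-- The predecessors of a node are ordered by their levels. -/
def iioIso (x : TreeNode κ b) : Iio x ≃o Iio x.level where
  toFun p := ⟨p.1.level, (lt_iff.1 p.2).1⟩
  invFun a := ⟨⟨a, x.carrier ∩ Iio a.1, x.isNode.restrict a.2.le⟩, lt_iff.2 ⟨a.2, rfl⟩⟩
  left_inv p := Subtype.ext (TreeNode.ext rfl (lt_iff.1 p.2).2)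
  right_inv _ := rfl
  map_rel_iff' {p q} := by
    refine ⟨fun h => ⟨h, ?_⟩, fun h => h.1⟩
    rw [← (lt_iff.1 p.2).2, ← (lt_iff.1 q.2).2]
    exact inter_Iio_inter_Iio h

variable [WellFoundedLT W]

instance : IsOrderTree (TreeNode κ b) where
  isWellOrder_Iio x := (iioIso x).toRelIsoLT.toRelEmbedding.isWellOrder

theorem nodeHeight_eq (x : TreeNode κ b) :
    nodeHeight x = Ordinal.typein (α := W) (· < ·) x.level := by
  have := IsOrderTree.isWellOrder_Iio x
  exact Ordinal.type_eq.2 ⟨(iioIso x).toRelIsoLT⟩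

theorem isHomogeneousTree : IsHomogeneousTree (TreeNode κ b) := by
  intro x y hxy
  rw [nodeHeight_eq, nodeHeight_eq] at hxy
  have hl : x.level = y.level := Ordinal.typein_injective _ hxy
  let φ : ∀ x y : TreeNode κ b, x.level = y.level → Ioi x → Ioi y := fun x y h z =>
    have hz : y.level < z.1.level := h ▸ (lt_iff.1 z.2).1
    ⟨⟨z.1.level, y.carrier ∪ z.1.carrier \ Iio y.level, y.isNode.graft z.1.isNode hz.le⟩,
      lt_iff.2 ⟨hz, graft_inter y.isNode.subset⟩⟩
  have hφ : ∀ (x y : TreeNode κ b) (h : x.level = y.level) (z : Ioi x), φ y x h.symm (φ x y h z) = z := by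
    intro x y h z
    refine Subtype.ext (TreeNode.ext rfl ?_)
    change x.carrier ∪ (y.carrier ∪ z.1.carrier \ Iio y.level) \ Iio x.level = z.1.carrier
    rw [← (lt_iff.1 z.2).2, ← h]
    ext w
    have h1 : w ∈ y.carrier → w < x.level := fun hw => h ▸ y.isNode.subset hw
    simp only [mem_union, mem_inter_iff, mem_sdiff, mem_Iio]
    tauto
  have hmono : ∀ (x y : TreeNode κ b) (h : x.level = y.level) (z w : Ioi x), z ≤ w →
      φ x y h z ≤ φ x y h w := by
    intro x y h z w hzw
    have hz : y.level ≤ z.1.level := h ▸ (lt_iff.1 z.2).1.le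
    refine ⟨hzw.1, ?_⟩
    change (y.carrier ∪ w.1.carrier \ Iio y.level) ∩ Iio z.1.level = y.carrier ∪ z.1.carrier \ Iio y.level
    rw [← hzw.2]
    ext v
    have h1 : v ∈ y.carrier → v < z.1.level := fun hv => (y.isNode.subset hv).trans_le hz
    simp only [mem_union, mem_inter_iff, mem_sdiff, mem_Iio]
    tauto
  exact ⟨{ toFun := φ x y hl
           invFun := φ y x hl.symm
           left_inv := hφ x y hl
           right_inv := hφ y x hl.symm
           map_rel_iff' := fun {z w} => ⟨fun h => by
             have := hmono y x hl.symm _ _ h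
             rwa [Equiv.coe_fn_mk, hφ x y hl, hφ x y hl] at this, hmono x y hl z w⟩ }⟩

/-- If the levels of the chain do not attain their supremum, it has cofinality below κ, so the union
of the chain meets no new condition there. -/
theorem isCompleteTree [NoMaxOrder W] (hκ : 1 < κ) (hκW : κ ≤ Order.cof W) :
    IsCompleteTree κ (TreeNode κ b) := by
  intro B hB hBκ
  let S : Set W := ⋃ p ∈ B, p.carrier
  have hS : ∀ p ∈ B, S ∩ Iio p.level = p.carrier := by
    intro p hp
    refine subset_antisymm ?_ fun y hy => ⟨mem_biUnion hp hy, p.isNode.subset hy⟩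
    rintro y ⟨hy, hyp⟩
    obtain ⟨q, hq, hyq⟩ := mem_iUnion₂.1 hy
    rcases hB.total hp hq with h | h
    · exact h.2.subset ⟨hyq, hyp⟩
    · exact (h.2.symm.subset hyq).1
  let lev : Set W := (fun p : TreeNode κ b => p.level) '' B
  have hlev : #lev < κ := mk_image_le.trans_lt hBκ
  have hbdd : BddAbove lev := by
    obtain ⟨c, hc⟩ := exists_forall_lt_of_card_lt_cof (hlev.trans_le hκW)
    exact ⟨c, fun x hx => (hc x hx).le⟩
  have hle : ∀ p ∈ B, p.level ≤ sSup lev := fun p hp => le_csSup hbdd ⟨p, hp, rfl⟩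
  have hnode : IsNode κ b (sSup lev) S := by
    constructor
    · refine iUnion₂_subset fun p hp => p.isNode.subset.trans (Iio_subset_Iio (hle p hp))
    · intro γ hγ hκγ
      by_cases h : ∃ p ∈ B, γ ≤ p.level
      · obtain ⟨p, hp, hγp⟩ := h
        obtain ⟨x, hx, hxy⟩ := p.isNode.agree γ hγp hκγ
        refine ⟨x, hx, fun y h1 h2 => ?_⟩
        rw [← hxy y h1 h2, ← hS p hp]
        exact ⟨fun h => ⟨h, h2.trans_le hγp⟩, fun h => h.1⟩
      · push Not at h
        have hγ' : γ = sSup lev := hγ.antisymm (csSup_le' (by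
          rintro _ ⟨p, hp, rfl⟩
          exact (h p hp).le))
        refine absurd (hκγ.trans (cof_Iio_le_of_cofinal (M := lev) fun x hx => ?_)) hlev.not_ge
        rw [hγ'] at hx
        obtain ⟨_, ⟨p, hp, rfl⟩, hxp⟩ := exists_lt_of_lt_csSup' hx
        exact ⟨_, ⟨p, hp, rfl⟩, hxp.le, h p hp⟩
  obtain ⟨c, hc⟩ := exists_covBy_of_wellFoundedLT (not_isMax (sSup lev))
  refine ⟨⟨c, S, hnode.succ hκ hc⟩, fun p hp => lt_iff.2 ⟨(hle p hp).trans_lt hc.1, hS p hp⟩⟩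

theorem treeHeight_eq [NoMaxOrder W] (hb : ∀ α, IsNode κ b α (b α)) :
    treeHeight (TreeNode κ b) = Ordinal.type (α := W) (· < ·) := by
  refine le_antisymm (csSup_le' ?_) (le_of_forall_lt fun o ho => ?_)
  · rintro _ ⟨x, rfl⟩
    exact (nodeHeight_eq x).trans_le (Ordinal.typein_lt_type _ _).le
  · obtain ⟨a, rfl⟩ := Ordinal.typein_surj (α := W) (· < ·) ho
    obtain ⟨c, hc⟩ := exists_gt a
    refine ((Ordinal.typein_lt_typein (α := W) (· < ·)).2 hc).trans_le ?_
    refine le_csSup Ordinal.bddAbove_of_small ⟨⟨c, b c, hb c⟩, nodeHeight_eq _⟩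

theorem isSouslinTree [NoMaxOrder W] {lam : Cardinal.{u}} (hlam : lam.IsSingular)
    (hW : Ordinal.type (α := W) (· < ·) = (Order.succ lam).ord)
    (hI : ∀ a : W, #(Iio a) ≤ lam) (hκ : 1 < κ) (hpow : ∀ μ < κ, lam ^ μ ≤ lam)
    (hb : ∀ α, IsNode κ b α (b α)) (hF : FollowsStrategies lam κ b) :
    IsSouslinTree (Order.succ lam) (TreeNode κ b) where
  treeHeight_eq := by rw [TreeNode.treeHeight_eq hb, hW]
  not_isChain B hB hchain := by
    have hunb : ∀ c : W, ∃ p ∈ B, c < p.level := by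
      intro c
      by_contra! h
      obtain ⟨d, hd⟩ := exists_gt c
      have h1 : #B ≤ lam := by
        refine (mk_le_of_injective (f := fun p : B =>
          (⟨(p.1.level, p.1.carrier), (h p.1 p.2).trans_lt hd, p.1.isNode⟩ :
            {p : W × Set W | p.1 < d ∧ IsNode κ b p.1 p.2})) ?_).trans
          (mk_nodes_below_le hlam.aleph0_le hI hpow d)
        intro p q hpq
        exact Subtype.ext (TreeNode.ext (congrArg (fun r => r.1.1) hpq)
          (congrArg (fun r => r.1.2) hpq))
      rw [hB] at h1
      exact (Order.lt_succ lam).not_ge h1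
    choose p hpB hp using hunb
    choose s hs using fun c : W => exists_covBy_of_wellFoundedLT (not_isMax c)
    -- `q c` leaves the chain exactly at c by flipping membership of c. Later `q d` still agree with
    -- the chain at c, so these nodes are incomparable.
    let q : W → W × Set W := fun c => (s c, {y | y < c ∧ y ∈ (p c).carrier ∨ y = c ∧ c ∉ (p c).carrier})
    have hq : ∀ c, IsNode κ b (q c).1 (q c).2 := by
      intro c
      refine ((p c).isNode.restrict (hp c).le).of_covBy hκ (hs c) ?_ ?_
      · rintro y (⟨h, -⟩ | ⟨rfl, -⟩)
        · exact h.trans (hs c).1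
        · exact (hs y).1
      · ext y
        simp only [q, mem_inter_iff, mem_ofPred_eq, mem_Iio]
        constructor
        · rintro ⟨⟨h1, h2⟩ | ⟨rfl, h2⟩, h3⟩
          · exact ⟨h2, h1⟩
          · exact absurd h3 (lt_irrefl _)
        · rintro ⟨h1, h2⟩
          exact ⟨Or.inl ⟨h2, h1⟩, h2⟩
    have hsmono : StrictMono s := fun c d h =>
      (not_lt.1 fun h' => (hs c).2 h h').trans_lt (hs d).1
    have hA := mk_antichain_le hlam hI hκ hpow hb hF (A := range q)
      (by rintro _ ⟨c, rfl⟩; exact hq c) (by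
        rintro _ ⟨c, rfl⟩ _ ⟨d, rfl⟩ hcd h
        have hcd' : c < d := hsmono.lt_iff_lt.1 hcd
        have h1 := Set.ext_iff.1 h c
        have h2 : c ∈ (p c).carrier ↔ c ∈ (p d).carrier := by
          rcases hchain.total (hpB c) (hpB d) with h | h
          · have := Set.ext_iff.1 h.2 c
            simpa [hp c] using this.symm
          · have := Set.ext_iff.1 h.2 c
            simpa [hcd'.trans (hp d)] using this
        have h3 : c < s c := (hs c).1
        simp only [q, mem_inter_iff, mem_ofPred_eq, mem_Iio, h3, hcd', hcd'.ne, lt_irrefl] at h1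
        tauto)
    have hqinj : Function.Injective q := fun c d h => hsmono.injective (congrArg Prod.fst h)
    rw [mk_range_eq q hqinj] at hA
    have hcard := congrArg Ordinal.card hW
    rw [Ordinal.card_type, card_ord] at hcard
    rw [hcard] at hA
    exact (Order.lt_succ lam).not_ge hA
  not_isAntichain B hB hanti := by
    let f : TreeNode κ b → W × Set W := fun x => (x.level, x.carrier)
    have hf : Function.Injective f := fun x y h =>
      TreeNode.ext (congrArg Prod.fst h) (congrArg Prod.snd h)
    have hA := mk_antichain_le hlam hI hκ hpow hb hF (A := f '' B)
      (by rintro _ ⟨x, -, rfl⟩; exact x.isNode) (by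
        rintro _ ⟨x, hx, rfl⟩ _ ⟨y, hy, rfl⟩ hxy h
        have hlt : x < y := lt_iff.2 ⟨hxy, h⟩
        exact hanti hx hy hlt.ne hlt.le)
    rw [mk_image_eq hf, hB] at hA
    exact (Order.lt_succ lam).not_ge hA

end TreeNode

end SquareSouslin


/-! ### From the square sequence to the theorem -/

namespace SquareSouslin

open Cardinal Set

theorem not_accumulatesAt_setOf_covBy {W : Type u} [ConditionallyCompleteLinearOrderBot W]
    (α γ : W) : ¬ AccumulatesAt {β | β ⋖ α} γ := by
  intro h
  obtain ⟨y, hy, -, hyγ⟩ := h.2 ⊥ h.1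
  obtain ⟨z, hz, hyz, -⟩ := h.2 y hyγ
  exact hyz.ne (hy.unique_left hz)

theorem AccumulatesAt.isSuccLimit {W : Type u} [ConditionallyCompleteLinearOrderBot W]
    {A : Set W} {γ : W} (h : AccumulatesAt A γ) : Order.IsSuccLimit γ := by
  refine ⟨fun hm => hm.not_lt h.1, fun x hx => ?_⟩
  obtain ⟨y, -, hxy, hyγ⟩ := h.2 x hx.1
  exact hx.2 hxy hyγ

/-- A `□`-sequence transferred to a well-order of type `lam⁺`. -/
theorem exists_ladder_of_jensenSquare {W : Type u} [ConditionallyCompleteLinearOrderBot W]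
    [WellFoundedLT W] {lam : Cardinal.{u}}
    (hW : Ordinal.type (α := W) (· < ·) = (Order.succ lam).ord) (hsq : JensenSquare lam) :
    ∃ C : W → Set W, IsCoherentLadder C ∧
      ∀ α, 1 < Order.cof (Iio α) → lam.ord.cof ≠ Order.cof (Iio α) → #(C α) < lam := by
  classical
  obtain ⟨S, hS⟩ := hsq
  let φ := Ordinal.typein (α := W) (· < ·)
  have hφlt : ∀ α, φ α < (Order.succ lam).ord := fun α => hW ▸ Ordinal.typein_lt_type _ α
  have hφ : ∀ {α β}, φ α < φ β ↔ α < β := Ordinal.typein_lt_typein (α := W) (· < ·)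
  have hφle : ∀ {α β}, φ α ≤ φ β ↔ α ≤ β := fun {α β} => by
    rw [← not_lt, ← not_lt, hφ]
  have hφinj : Function.Injective φ := Ordinal.typein_injective _
  have hφsurj : ∀ {o α}, o < φ α → ∃ β, φ β = o := fun {o α} h =>
    Ordinal.typein_surj (α := W) (· < ·) (h.trans (Ordinal.typein_lt_type _ α))
  have hlim : ∀ {α : W}, Order.IsSuccLimit α → Order.IsSuccLimit (φ α) :=
    fun h => φ.isSuccLimit_apply_iff.2 h
  -- A successor receives its predecessor as its only ladder point, and ⊥ the empty ladder.
  let C : W → Set W := fun α =>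
    if Order.IsSuccLimit α then {β | φ β ∈ S (φ α)} else {β | β ⋖ α}
  have hClim : ∀ {α}, Order.IsSuccLimit α → C α = {β | φ β ∈ S (φ α)} := fun h => if_pos h
  have hCsucc : ∀ {α}, ¬ Order.IsSuccLimit α → C α = {β | β ⋖ α} := fun h => if_neg h
  have hlt : ∀ {α β}, β ∈ C α → β < α := by
    intro α β hβ
    by_cases hα : Order.IsSuccLimit α
    · rw [hClim hα] at hβ
      exact hφ.1 ((hS.isClubIn _ (hφlt α) (hlim hα)).1 hβ)
    · rw [hCsucc hα] at hβ
      exact hβ.1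
  have hcofinal : ∀ {α x}, x < α → ∃ β ∈ C α, x ≤ β := by
    intro α x hx
    by_cases hα : Order.IsSuccLimit α
    · rw [hClim hα]
      obtain ⟨⟨o, ho⟩, hoS, hxo⟩ :=
        (hS.isClubIn _ (hφlt α) (hlim hα)).2.isCofinal ⟨φ x, hφ.2 hx⟩
      obtain ⟨β, rfl⟩ := hφsurj ho
      exact ⟨β, hoS, hφle.1 hxo⟩
    · rw [hCsucc hα]
      have : ¬ Order.IsSuccPrelimit α := fun h => hα ⟨fun h' => h'.not_lt hx, h⟩
      obtain ⟨β, hβ⟩ := Order.not_isSuccPrelimit_iff.1 this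
      exact ⟨β, hβ, not_lt.1 fun h => hβ.2 h hx⟩
  have key : ∀ {α γ}, γ < α → AccumulatesAt (C α) γ → γ ∈ C α ∧ C γ = C α ∩ Iio γ := by
    intro α γ hγα hγ
    by_cases hα : Order.IsSuccLimit α
    · rw [hClim hα] at hγ ⊢
      have hclub := hS.isClubIn _ (hφlt α) (hlim hα)
      have hγS : φ γ ∈ S (φ α) := by
        refine hclub.2.isLUB_mem (x := ⟨φ γ, hφ.2 hγα⟩)
          (t := {o | o.1 ∈ S (φ α) ∧ o.1 < φ γ}) (fun o ho => ho.1) ?_ ⟨fun o ho => ho.2.le, ?_⟩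
        · obtain ⟨y, hy, -, hyγ⟩ := hγ.2 ⊥ hγ.1
          exact ⟨⟨φ y, hφ.2 (hyγ.trans hγα)⟩, hy, hφ.2 hyγ⟩
        · rintro ⟨o, ho⟩ hub
          obtain ⟨x, rfl⟩ := hφsurj ho
          by_contra hcon
          have hxγ : x < γ := hφ.1 (not_le.1 hcon)
          obtain ⟨y, hy, hxy, hyγ⟩ := hγ.2 x hxγ
          have h1 : (⟨φ y, hφ.2 (hyγ.trans hγα)⟩ : Iio (φ α)) ≤ ⟨φ x, ho⟩ :=
            hub ⟨hy, hφ.2 hyγ⟩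
          exact (hφle.1 h1).not_gt hxy
      have hacc : φ γ ∈ accPoints (S (φ α)) := by
        refine ⟨hγS, (bot_le.trans_lt (hφ.2 hγ.1)).ne', le_antisymm (csSup_le' fun o ho => ho.2.le) ?_⟩
        refine le_of_forall_lt fun o ho => ?_
        obtain ⟨x, rfl⟩ := hφsurj ho
        obtain ⟨y, hy, hxy, hyγ⟩ := hγ.2 x (hφ.1 ho)
        exact (hφ.2 hxy).trans_le (le_csSup ⟨φ γ, fun o ho => ho.2.le⟩ ⟨hy, hφ.2 hyγ⟩)
      refine ⟨hγS, ?_⟩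
      rw [hClim hγ.isSuccLimit, hS.coherent _ (hφlt α) (hlim hα) _ hacc]
      ext y
      exact and_congr_right fun _ => hφ
    · rw [hCsucc hα] at hγ
      exact absurd hγ (not_accumulatesAt_setOf_covBy α γ)
  refine ⟨C, ⟨fun α β h => hlt h, fun α x h => hcofinal h, fun α γ h h' => (key h h').1,
    fun α γ h h' => (key h h').2⟩, fun α hα1 hα => ?_⟩
  have hαlim : Order.IsSuccLimit α := by
    refine ⟨fun hm => hm.not_lt (bot_lt_of_cof_ne_zero (zero_lt_one.trans hα1).ne'), fun x hx => ?_⟩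
    obtain ⟨y, hxy, hy⟩ := exists_between_of_one_lt_cof hα1 hx.1
    exact hx.2 hxy hy
  -- A ladder with `lam` points would have order type exactly `lam`, forcing the cofinality of α to
  -- be that of `lam`.
  by_contra! hcard
  have h1 : Ordinal.lift.{u + 1} (Ordinal.type (α := C α) (· < ·)) = otp (S (φ α)) := by
    rw [← Ordinal.lift_id'.{u, u + 1} (otp (S (φ α)))]
    refine Ordinal.lift_type_eq.2 ⟨?_⟩
    have hmem : ∀ β : C α, φ β ∈ S (φ α) := fun β => (hClim hαlim).subset β.2
    refine ⟨Equiv.ofBijective (fun β : C α => (⟨φ β, hmem β⟩ : S (φ α))) ⟨?_, ?_⟩, hφ⟩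
    · intro β β' h
      exact Subtype.ext (hφinj (congrArg Subtype.val h))
    · rintro ⟨o, ho⟩
      obtain ⟨β, rfl⟩ := hφsurj ((hS.isClubIn _ (hφlt α) (hlim hαlim)).1 ho)
      exact ⟨⟨β, by rw [hClim hαlim]; exact ho⟩, rfl⟩
  have h2 : Ordinal.type (α := C α) (· < ·) ≤ lam.ord := by
    have := hS.otp_le _ (hφlt α) (hlim hαlim)
    rwa [← h1, Ordinal.lift_le] at this
  have h3 : Ordinal.type (α := C α) (· < ·) = lam.ord :=
    h2.antisymm (ord_le.2 (by rwa [Ordinal.card_type]))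
  refine hα ?_
  rw [← h3, Ordinal.cof_type]
  refine Order.cof_congr_of_strictMono (f := fun a : C α => (⟨a, hlt a.2⟩ : Iio α))
    (fun a b hab => hab) fun y => ?_
  obtain ⟨z, hz, hyz⟩ := hcofinal y.2
  exact ⟨_, ⟨⟨z, hz⟩, rfl⟩, hyz⟩

/-- Boundedness keeps the count at lam⁺ · 2^lam ≤ lam^lam, and (lam^lam)^lam = lam^lam. -/
theorem mk_bounded_pairs_power_le {W : Type u} [ConditionallyCompleteLinearOrderBot W]
    {lam : Cardinal.{u}} (hω : ℵ₀ ≤ lam) (hpow : lam ^ lam = Order.succ lam)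
    (hW : #W = Order.succ lam) (hI : ∀ a : W, #(Iio a) ≤ lam) :
    #{p : W × Set W // p.2 ⊆ Iio p.1} ^ lam ≤ #W := by
  have h1 : #{p : W × Set W // p.2 ⊆ Iio p.1} ≤ Order.succ lam := by
    let φ : {p : W × Set W // p.2 ⊆ Iio p.1} → Σ a : W, Set (Iio a) :=
      fun p => ⟨p.1.1, Subtype.val ⁻¹' p.1.2⟩
    have hφ : Function.Injective φ := by
      refine Function.LeftInverse.injective
        (g := fun q => ⟨(q.1, Subtype.val '' q.2), by rintro _ ⟨x, -, rfl⟩; exact x.2⟩) fun p => ?_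
      refine Subtype.ext (Prod.ext rfl ?_)
      change Subtype.val '' (Subtype.val ⁻¹' p.1.2 : Set (Iio p.1.1)) = p.1.2
      rw [Subtype.image_preimage_coe, inter_eq_right.2 p.2]
    refine (mk_le_of_injective hφ).trans ?_
    rw [mk_sigma]
    refine (sum_le_sum (fun a : W => #(Set (Iio a))) (fun _ => Order.succ lam) fun a => ?_).trans ?_
    · rw [mk_set, ← hpow]
      refine (power_le_power_left two_ne_zero (hI a)).trans (power_le_power_right ?_)
      exact (natCast_lt_aleph0 (n := 2)).le.trans hω
    · rw [sum_const, lift_id, lift_id, hW]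
      exact (mul_eq_self (hω.trans (Order.le_succ _))).le
  rw [hW]
  refine (power_le_power_right h1).trans ?_
  rw [← hpow, ← power_mul, mul_eq_self hω]

end SquareSouslin

theorem theoremC (lam : Cardinal.{u}) (hsing : lam.IsSingular) (hsq : JensenSquare lam)
    (hlt : Cardinal.powerlt lam lam.ord.cof < lam ^ lam) (hpow : lam ^ lam = Order.succ lam) :
    ∃ (T : Type u) (_ : PartialOrder T) (_ : IsOrderTree T),
      IsSouslinTree (Order.succ lam) T ∧ IsHomogeneousTree T ∧ IsCompleteTree lam.ord.cof T := by
  open Cardinal SquareSouslin in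
  have hω := hsing.aleph0_le
  have hreg := isRegular_succ hω
  let W : Type u := (Order.succ lam).ord.ToType
  have hne : Nonempty W := by rw [← mk_ne_zero_iff]; simp [W]
  let : OrderBot W := WellFoundedLT.toOrderBot W
  let : ConditionallyCompleteLinearOrderBot W :=
    WellFoundedLT.conditionallyCompleteLinearOrderBot W
  have : NoMaxOrder W := Cardinal.noMaxOrder hreg.aleph0_le
  have hW : Ordinal.type (α := W) (· < ·) = (Order.succ lam).ord := Ordinal.type_toType _
  have hcard : #W = Order.succ lam := mk_ord_toType _
  have hcof : Order.cof W = Order.succ lam := by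
    rw [← hreg.cof_ord]
    exact Ordinal.cof_toType _
  have hI : ∀ a : W, #(Set.Iio a) ≤ lam := fun a =>
    Order.lt_succ_iff.1 (mk_Iio_lt_of_toType a)
  have hlamW : lam < Order.cof W := hcof ▸ Order.lt_succ lam
  have hκ : 1 < lam.ord.cof := Ordinal.one_lt_cof_iff.2 (isSuccLimit_ord hω)
  have hpow' : ∀ μ < lam.ord.cof, lam ^ μ ≤ lam := fun μ hμ =>
    (le_powerlt lam hμ).trans (Order.lt_succ_iff.1 (hpow ▸ hlt))
  obtain ⟨C, hC, hCcard⟩ := exists_ladder_of_jensenSquare hW hsq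
  have : Nonempty {p : W × Set W // p.2 ⊆ Set.Iio p.1} := ⟨⟨(⊥, ∅), Set.empty_subset _⟩⟩
  obtain ⟨D, g, hD, hg⟩ := hC.exists_guessing hsing hlamW hI
    (fun α hα => hCcard α (hκ.trans hα) hα.ne) (mk_bounded_pairs_power_le hω hpow hcard hI)
  obtain ⟨b, hb⟩ := exists_branch (κ := lam.ord.cof) (g := fun β τ => (g β τ).1)
    fun α β hβ => hD.lt (α := α) hβ
  have hnode := isNode_branch hκ hD hb
  have hF := followsStrategies hκ (hω.trans_lt hlamW) (fun a => (hI a).trans_lt hlamW) hD hb hg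
  exact ⟨TreeNode lam.ord.cof b, inferInstance, inferInstance,
    TreeNode.isSouslinTree hsing hW hI hκ hpow' hnode hF, TreeNode.isHomogeneousTree,
    TreeNode.isCompleteTree hκ (hsing.cof_ord_lt.le.trans hlamW.le)⟩
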